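/- **Fault-prone systems.** A fault-prone system has a set $Loc$ of locations, partitioned into a fault-tolerant part $T$ and a faulty part $F$; its states are the maps $S\colon Loc\to\{0,1\}$; it has a set $Act$ of actions with a silent action $\tau$ and a set $LAct\subseteq Act$ of public actions; and it has a deterministic transition relation $S\xrightarrow{a}S'$. $S$ is *stuck* if it has no transition. $low(a)=a$ for $a\in LAct$, and $low(a)=\tau$ otherwise. $flip(S,L)$ is $S$ with the bits in $L$ flipped. The locations are also partitioned into program, low and high locations. A *program component* is an assignment of bits to the program locations; $S=_{\mathcal L}S'$ means that $S,S'$ agree on the low locations. *PoNI.* The augmented system has, for every $L\subseteq F$, the transitions: $S\stackrel{L,a}{\rightsquigarrow}S'$ if $S$ is not stuck and $flip(S,L)\xrightarrow{a}S'$; $S\stackrel{L,\tau}{\rightsquigarrow}flip(S,L)$ if $S$ is not stuck but $flip(S,L)$ is; $S\stackrel{L,\tau}{\rightsquigarrow}S$ if $S$ is stuck. A run with labels $(L_0,a_0),\dots,(L_{n-1},a_{n-1})$ has the trace $L_0,low(a_0),\dots,L_{n-1},low(a_{n-1})$. A program component is *PoNI* if any two low-equivalent states with this program component have the same traces. *PNI.*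 A fault environment is a labelled transition system that in each state $E$ has exactly one successor for each label in $LAct\cup\{\tau\}$, and has in each state $E$ a probability distribution $Fault(E)$ on the subsets of $F$. In the composition, if $S$ is not stuck, then $(S,E)$ goes with action $a$ to $(S',E')$ with probability $\sum_{L:\,flip(S,L)\xrightarrow{a}S'}Fault(E)(L)$, where $E\xrightarrow{low(a)}E'$, and with action $\tau$ to $(flip(S,L),E')$ with probability $Fault(E)(L)$ for each $L$ with $flip(S,L)$ stuck, where $E\xrightarrow{\tau}E'$; if $S$ is stuck, then $(S,E)$ goes with action $\tau$ and probability $1$ to $(S,E')$, where $E\xrightarrow{\tau}E'$. The probability of $t\in(LAct\cup\{\tau\})^n$ from $(S,E)$ is the sum, over the runs of length $n$ whose actions $a_i$ satisfy $low(a_i)=t_i$, of the product of their transition probabilities. A program component is *PNI* if for any two low-equivalent states $S,S'$ with this program component, any state $E$ of any environment and any $t$, the probabilities of $t$ from $(S,E)$ and $(S',E)$ are equal. **The RISC machine.** Constants are the $w$-bit words. A state $\langle P,pc,R,M\rangle$ consists of a code memory $P$, a word $pc$, a register bank $R\colon Reg\to Const$ and a memory $M\colon Const\to Const$. $P$ is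 a list of optionally labelled instructions, in which no label is attached to two instructions, and which has fewer than $2^w$ instructions (so that every position in it, and the one after its end, is a word). Instructions are $load\ r\ p$ ($R(r):=M(p)$), $store\ p\ r$ ($M(p):=R(r)$), $jmp\ l$, $jz\ l\ r$ (jump to $l$ if $R(r)=0$), $nop$, $movek\ r\ k$, $mover\ r\ r'$, $op\ r\ r'$ ($R(r):=R(r)\ op\ R(r')$, for binary operators $op$) and $out\ ch\ r$ with $ch\in\{low,high\}$. Except for a jump taken, $pc$ is incremented; a jump taken to a label that does not occur in $P$ has no transition, and neither has a $pc$ outside $P$. The action is $ch!R(r)$ for $out\ ch\ r$ and $\tau$ otherwise; the public actions are the $low!k$. Locations are the individual bits of the components, the code being represented in bits by an arbitrary injective encoding (assignments of bits that represent no state are stuck). The bits of registers and memory are faulty; code memory and program counter are fault-tolerant and form the program locations. Registers and variables have levels in $\{L\sqsubseteq H\}$; an injection $v2p$ places the variables in memory; register bits, and bits of the cells of variables, are low or high according to the level, and the other memory cells have arbitrary fixed levels. A program $P$ is PoNI (PNI) if the program component $(P,0)$, with program counter $0$, is. **While programs.** $E::=k\mid x\mid E_1\ op\ E_2$ and $C::=skip\mid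 x:=E\mid if\ E\ C_1\ C_2\mid out\ ch\ E\mid C_1;C_2\mid while\ x\ C$. **Compilation.** A register record $\Phi$ is a partial bijection between registers and variables; $\Phi[r\leftrightarrow x]$ adds $(r,x)$ after removing all other pairs with $r$ or $x$; $\Phi[r\not\to]$ removes the pair with $r$. $\varepsilon_{lab}$ is the empty label, and $\varepsilon_I$ the empty instruction: in a concatenation $+\!\!+$, $[l:\varepsilon_I]$ vanishes and passes $l$ to the instruction that follows; $l:P$ is $[l:\varepsilon_I]+\!\!+P$. Timings are $Trm\,0\sqsubseteq Trm\,1\sqsubseteq\dots\sqsubseteq Trm\,L\sqsubseteq Trm\,H$; $t_1\underline{\sqcup}t_2$ is $Trm\,L$ if $t_1,t_2\sqsubseteq Trm\,L$ and $Trm\,H$ otherwise; $t_1\uplus t_2$ is $Trm\,(n_1+n_2)$ if $t_i=Trm\,n_i$ for $i=1,2$, and $t_1\underline{\sqcup}t_2$ otherwise. Write effects are $wr\,H\sqsubseteq\top$; $write(H)=wr\,H$, $write(L)=\top$, $term(\lambda)=Trm\,\lambda$. The judgement $\Phi,A,l\Vdash E\hookrightarrow P,\langle\lambda,n\rangle,r,\Phi'$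 for expressions is given by: - $\Phi,A,l\Vdash k\hookrightarrow[l:movek\ r\ k],\langle level(r),1\rangle,r,\Phi[r\not\to]$ if $r\notin A$; - $\Phi,A,l\Vdash x\hookrightarrow[l:\varepsilon_I],\langle level(r),0\rangle,r,\Phi$ if $(r,x)\in\Phi$; - $\Phi,A,l\Vdash x\hookrightarrow[l:load\ r\ v2p(x)],\langle level(r),1\rangle,r,\Phi[r\leftrightarrow x]$ if $r\notin A$ and $level(x)\sqsubseteq level(r)$; - $\Phi,A,l\Vdash E_1\,op\,E_2\hookrightarrow P_1+\!\!+P_2+\!\!+[op\ r\ r'],\langle\lambda,n_1+n_2+1\rangle,r,\Phi_2[r\not\to]$ if $\Phi,A,l\Vdash E_1\hookrightarrow P_1,\langle\lambda,n_1\rangle,r,\Phi_1$ and $\Phi_1,A\cup\{r\},\varepsilon_{lab}\Vdash E_2\hookrightarrow P_2,\langle\lambda,n_2\rangle,r',\Phi_2$. The judgement $\Phi,l\vdash C\hookrightarrow P,\langle t,w\rangle,l',\Phi'$ for commands is given by the following rules, in which a *fresh* label is one that is generated nowhere else in the derivation: - $\Phi,l\vdash skip\hookrightarrow[l:nop],\langle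 Trm\,1,wr\,H\rangle,\varepsilon_{lab},\Phi$; - if $\Phi,\emptyset,l\Vdash E\hookrightarrow P,\langle level(x),n\rangle,r,\Phi'$, then $\Phi,l\vdash x:=E\hookrightarrow P+\!\!+[store\ v2p(x)\ r],\langle t,w\rangle,\varepsilon_{lab},\Phi'[r\leftrightarrow x]$, with $\langle t,w\rangle=\langle Trm\,(n+1),wr\,H\rangle$ if $level(x)=H$ and $\langle Trm\,L,\top\rangle$ otherwise; - if $\Phi,\emptyset,l\Vdash E\hookrightarrow P,\langle level(ch),n\rangle,r,\Phi'$, then $\Phi,l\vdash out\ ch\ E\hookrightarrow P+\!\!+[out\ ch\ r],\langle t,w\rangle,\varepsilon_{lab},\Phi'$, with $\langle t,w\rangle$ as before but for $level(ch)$ (the level of $low$ is $L$, that of $high$ is $H$); - if $\Phi,\emptyset,l\Vdash E\hookrightarrow P_0,\langle\lambda,n_0\rangle,r,\Phi_1$ and, for $i=1,2$, $\Phi_1,\varepsilon_{lab}\vdash C_i\hookrightarrow P_i,\langle t_i,w_i\rangle,l_i,\Phi_{i+1}$ with $w_i\sqsubseteq write(\lambda)$, and $br,ex$ are fresh, then $\Phi,l\vdash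 if\ E\ C_1\ C_2\hookrightarrow P_0+\!\!+[jz\ br\ r]+\!\!+P_1+\!\!+[l_1:jmp\ ex]+\!\!+br:P_2+\!\!+[l_2:nop],\ \langle term(\lambda)\underline{\sqcup}t_1\underline{\sqcup}t_2,write(\lambda)\rangle,ex,\Phi_2\cap\Phi_3$; - if in the previous rule $\lambda=H$ and $t_i=Trm\,n_i$, $w_i=wr\,H$ for $i=1,2$, then also $\Phi,l\vdash if\ E\ C_1\ C_2\hookrightarrow P_0+\!\!+[jz\ br\ r]+\!\!+P_1+\!\!+l_1:nop^{n_2-n_1}+\!\!+[jmp\ ex]+\!\!+br:P_2+\!\!+l_2:nop^{n_1-n_2}+\!\!+[nop],\ \langle Trm\,(n_0+\max(n_1,n_2)+2),wr\,H\rangle,ex,\Phi_2\cap\Phi_3$, where $nop^m=\varepsilon_I$ for $m\le0$; - if $\Phi,l\vdash C_1\hookrightarrow P_1,\langle t_1,w_1\rangle,l_1,\Phi_1$ and $\Phi_1,l_1\vdash C_2\hookrightarrow P_2,\langle t_2,w_2\rangle,l_2,\Phi_2$, and $t_1=Trm\,H$ implies $w_2=wr\,H$, then $\Phi,l\vdash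 C_1;C_2\hookrightarrow P_1+\!\!+P_2,\langle t_1\uplus t_2,w_1\sqcup w_2\rangle,l_2,\Phi_2$; - if $\lambda=level(x)=level(r)$, $\Phi_B,\varepsilon_{lab}\vdash C\hookrightarrow P,\langle t,w\rangle,l',\Phi_E$, $\Phi_B\subseteq\Phi[r\leftrightarrow x]$, $\Phi_B\subseteq\Phi_E[r\leftrightarrow x]$, $w\sqsubseteq write(\lambda)$, $t=Trm\,H$ implies $write(\lambda)=wr\,H$, and $lp,ex$ are fresh, then $\Phi,l\vdash while\ x\ C\hookrightarrow l:P_i+\!\!+[lp:jz\ ex\ r]+\!\!+P+\!\!+l':P_i+\!\!+[jmp\ lp],\ \langle term(\lambda)\underline{\sqcup}t,write(\lambda)\rangle,ex,\Phi_B$, where $P_i=[load\ r\ v2p(x),\ store\ v2p(x)\ r]$. **Corollary (PoNI enforcement on RISC programs).** Let $C$ be a while program and suppose that $\{\},\varepsilon_{lab}\vdash C\hookrightarrow P,\langle t,w\rangle,l,\Phi$, where $P$ is a RISC program (a code memory of the machine). Then $P$ is PoNI on the RISC machine with fault-tolerant code memory and program counter, and consequently $P$ is PNI. -/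

import Mathlib

open scoped ENNReal

universe v

namespace FTNI

/-! ### Fault-prone systems, possibilistic and probabilistic fault-tolerant non-interference -/

/-- A deterministic labelled transition system whose states are all assignments of bits to
locations.  `F` is the set of faulty locations (its complement is the fault-tolerant part `T`),
`tau` the silent action, `LAct` the set of publicly observable actions. -/
structure FaultProneSystem (Loc : Type*) (Act : Type*) where
  F : Set Loc
  tau : Act
  LAct : Set Act
  step : (Loc → Bool) → Act → (Loc → Bool) → Prop
  det : ∀ {S a S₁ b S₂}, step S a S₁ → step S b S₂ → a = b ∧ S₁ = S₂

/-- The component of a state to which a location belongs; a map `Loc → Region` is a partition of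
the locations into `ProgLoc`, `LowLoc` and `HighLoc`. -/
inductive Region
  | prog
  | low
  | high

/-- A program component: an assignment of bits to the program locations. -/
def ProgComp {Loc : Type*} (region : Loc → Region) : Type _ :=
  {l : Loc // region l = Region.prog} → Bool

/-- The program component of a state. -/
def progOf {Loc : Type*} (region : Loc → Region) (S : Loc → Bool) : ProgComp region :=
  fun l => S l.1

/-- Low equivalence of states: they agree on all low locations. -/
def LowEq {Loc : Type*} (region : Loc → Region) (S S' : Loc → Bool) : Prop :=
  ∀ l, region l = Region.low → S l = S' l

open Classical in
/-- Flip the bits of `S` at exactly the locations in `L`. -/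
noncomputable def flip {Loc : Type*} (S : Loc → Bool) (L : Set Loc) : Loc → Bool :=
  fun l => if l ∈ L then !(S l) else S l

namespace FaultProneSystem

variable {Loc : Type*} {Act : Type*}

/-- What the attacker observes: an element of `LAct ∪ {τ}`. -/
def Obs (Y : FaultProneSystem Loc Act) : Type _ := {a : Act // a ∈ Y.LAct ∪ {Y.tau}}

open Classical in
/-- The public view of an action: the identity on `LAct`, and `τ` on all other actions. -/
noncomputable def low (Y : FaultProneSystem Loc Act) (a : Act) : Y.Obs :=
  if h : a ∈ Y.LAct then ⟨a, Or.inl h⟩ else ⟨Y.tau, Or.inr rfl⟩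

/-- Sets of faulty locations. -/
def FaultSet (Y : FaultProneSystem Loc Act) : Type _ := {L : Set Loc // L ⊆ Y.F}

/-- A state is stuck if it has no transition. -/
def Stuck (Y : FaultProneSystem Loc Act) (S : Loc → Bool) : Prop :=
  ∀ a S', ¬ Y.step S a S'

/-- Transitions of the augmented system, labelled by the fault set and the action. -/
inductive AugStep (Y : FaultProneSystem Loc Act) :
    (Loc → Bool) → Y.FaultSet → Act → (Loc → Bool) → Prop
  | exec {S S' : Loc → Bool} {L : Y.FaultSet} {a : Act} :
      ¬ Y.Stuck S → Y.step (flip S L.1) a S' → AugStep Y S L a S'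
  | madeStuck {S : Loc → Bool} {L : Y.FaultSet} :
      ¬ Y.Stuck S → Y.Stuck (flip S L.1) → AugStep Y S L Y.tau (flip S L.1)
  | stuck {S : Loc → Bool} {L : Y.FaultSet} :
      Y.Stuck S → AugStep Y S L Y.tau S

/-- `HasTrace Y S t`: some possibilistic run of `S` has the trace
`t = L₀, low a₀, …, Lₙ₋₁, low aₙ₋₁`. -/
inductive HasTrace (Y : FaultProneSystem Loc Act) :
    (Loc → Bool) → List (Y.FaultSet × Y.Obs) → Prop
  | nil (S : Loc → Bool) : HasTrace Y S []
  | cons {S S' : Loc → Bool} {L : Y.FaultSet} {a : Act} {t : List (Y.FaultSet × Y.Obs)} :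
      Y.AugStep S L a S' → HasTrace Y S' t → HasTrace Y S ((L, Y.low a) :: t)

/-- Possibilistic fault-tolerant non-interference of the program component `P`. -/
def PoNI (Y : FaultProneSystem Loc Act) (region : Loc → Region) (P : ProgComp region) : Prop :=
  ∀ S S' : Loc → Bool, progOf region S = P → progOf region S' = P → LowEq region S S' →
    ∀ t : List (Y.FaultSet × Y.Obs), Y.HasTrace S t ↔ Y.HasTrace S' t

/-- A fault environment: a labelled transition system that has, for each state and each
observation, exactly one successor (`next`), and in each state a probability distribution over
the sets of faulty locations. -/
structure FaultEnv {Loc : Type*} {Act : Type*} (Y : FaultProneSystem Loc Act) where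
  State : Type v
  next : State → Y.Obs → State
  fault : State → PMF Y.FaultSet

/-- Transitions of the composition of a system and an environment, labelled with an action and
a probability. -/
inductive CompStep (Y : FaultProneSystem Loc Act) (V : FaultEnv Y) :
    (Loc → Bool) × V.State → Act → ℝ≥0∞ → (Loc → Bool) × V.State → Prop
  | step {S S' : Loc → Bool} {E : V.State} {a : Act} :
      ¬ Y.Stuck S → (∃ L : Y.FaultSet, Y.step (flip S L.1) a S') →
      CompStep Y V (S, E) a (∑' L : {L : Y.FaultSet // Y.step (flip S L.1) a S'}, V.fault E L.1)
        (S', V.next E (Y.low a))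
  | stuck1 {S : Loc → Bool} {E : V.State} {L : Y.FaultSet} :
      ¬ Y.Stuck S → Y.Stuck (flip S L.1) →
      CompStep Y V (S, E) Y.tau (V.fault E L) (flip S L.1, V.next E (Y.low Y.tau))
  | stuck2 {S : Loc → Bool} {E : V.State} :
      Y.Stuck S → CompStep Y V (S, E) Y.tau 1 (S, V.next E (Y.low Y.tau))

/-- `IsRun Y V Z r`: the list `r` of (action, probability, target) triples is a run from `Z`. -/
inductive IsRun (Y : FaultProneSystem Loc Act) (V : FaultEnv Y) :
    (Loc → Bool) × V.State → List (Act × ℝ≥0∞ × ((Loc → Bool) × V.State)) → Prop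
  | nil (Z : (Loc → Bool) × V.State) : IsRun Y V Z []
  | cons {Z Z' : (Loc → Bool) × V.State} {a : Act} {p : ℝ≥0∞}
      {r : List (Act × ℝ≥0∞ × ((Loc → Bool) × V.State))} :
      CompStep Y V Z a p Z' → IsRun Y V Z' r → IsRun Y V Z ((a, p, Z') :: r)

/-- The probability `Pr_Z(t)`: the sum, over the runs from `Z` with trace `t`, of the product of
the probabilities of their transitions. -/
noncomputable def traceProb (Y : FaultProneSystem Loc Act) (V : FaultEnv Y)
    (Z : (Loc → Bool) × V.State) (t : List Y.Obs) : ℝ≥0∞ :=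
  ∑' r : {r : List (Act × ℝ≥0∞ × ((Loc → Bool) × V.State)) //
      IsRun Y V Z r ∧ r.map (fun x => Y.low x.1) = t},
    (r.1.map (fun x => x.2.1)).prod

/-- Probabilistic fault-tolerant non-interference of the program component `P`. -/
def PNI (Y : FaultProneSystem Loc Act) (region : Loc → Region) (P : ProgComp region) : Prop :=
  ∀ S S' : Loc → Bool, progOf region S = P → progOf region S' = P → LowEq region S S' →
    ∀ (V : FaultEnv.{v} Y) (E : V.State) (t : List Y.Obs),
      traceProb Y V (S, E) t = traceProb Y V (S', E) t

end FaultProneSystem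

/-! ### The RISC machine -/

/-- Security levels. -/
inductive Level
  | L
  | H

/-- `L ⊑ H`, reflexive. -/
def Level.le : Level → Level → Prop
  | .H, .L => False
  | _, _ => True

/-- Output channels. -/
inductive Channel
  | low
  | high

def Channel.level : Channel → Level
  | .low => .L
  | .high => .H

/-- Instruction bodies, over `w`-bit words; `eps` is the empty instruction, which is only used
during compilation. -/
inductive Body (w : ℕ) (Reg Lab Op : Type*)
  | load (r : Reg) (p : BitVec w)
  | store (p : BitVec w) (r : Reg)
  | jmp (l : Lab)
  | jz (l : Lab) (r : Reg)
  | nop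
  | movek (r : Reg) (k : BitVec w)
  | mover (r r' : Reg)
  | op (o : Op) (r r' : Reg)
  | out (ch : Channel) (r : Reg)
  | eps

/-- An optionally labelled instruction; the label `none` is the empty label. -/
structure Instr (w : ℕ) (Reg Lab Op : Type*) where
  lab : Option Lab
  body : Body w Reg Lab Op

/-- Well-formed code: no empty instruction, no label on two instructions, and every position,
including the one just after the last instruction, is representable in a machine word. -/
structure WellFormed {w : ℕ} {Reg Lab Op : Type*} (P : List (Instr w Reg Lab Op)) : Prop where
  no_eps : ∀ I ∈ P, I.body ≠ Body.eps
  lab_unique : ∀ (i j : ℕ) (I J : Instr w Reg Lab Op) (l : Lab), P[i]? = some I →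
    P[j]? = some J → I.lab = some l → J.lab = some l → i = j
  fits : P.length < 2 ^ w

/-- Code memories, that is, RISC programs. -/
def Code (w : ℕ) (Reg Lab Op : Type*) : Type _ :=
  {P : List (Instr w Reg Lab Op) // WellFormed P}

/-- Actions of the machine: outputs `ch!k` and the silent action. -/
inductive Action (w : ℕ)
  | tau
  | out (ch : Channel) (k : BitVec w)

/-- Machine states `⟨P, pc, R, M⟩`. -/
structure RState (w : ℕ) (Reg Lab Op : Type*) where
  code : Code w Reg Lab Op
  pc : BitVec w
  reg : Reg → BitVec w
  mem : BitVec w → BitVec w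

/-- The body of the instruction at the current position, if any. -/
def RState.fetch {w : ℕ} {Reg Lab Op : Type*} (s : RState w Reg Lab Op) :
    Option (Body w Reg Lab Op) :=
  (s.code.1[s.pc.toNat]?).map Instr.body

/-- `Res P l i`: the label `l` occurs in `P` at position `i`. -/
def Res {w : ℕ} {Reg Lab Op : Type*} (P : Code w Reg Lab Op) (l : Lab) (i : BitVec w) : Prop :=
  ∃ I, P.1[i.toNat]? = some I ∧ I.lab = some l

/-- The instruction semantics.  A jump to a label that does not occur in the code has no
transition. -/
inductive RStep {w : ℕ} {Reg Lab Op : Type*} [DecidableEq Reg]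
    (opSem : Op → BitVec w → BitVec w → BitVec w) :
    RState w Reg Lab Op → Action w → RState w Reg Lab Op → Prop
  | load {s : RState w Reg Lab Op} {r : Reg} {p : BitVec w} :
      s.fetch = some (.load r p) →
      RStep opSem s .tau ⟨s.code, s.pc + 1, Function.update s.reg r (s.mem p), s.mem⟩
  | store {s : RState w Reg Lab Op} {r : Reg} {p : BitVec w} :
      s.fetch = some (.store p r) →
      RStep opSem s .tau ⟨s.code, s.pc + 1, s.reg, Function.update s.mem p (s.reg r)⟩
  | jmp {s : RState w Reg Lab Op} {l : Lab} {i : BitVec w} :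
      s.fetch = some (.jmp l) → Res s.code l i →
      RStep opSem s .tau ⟨s.code, i, s.reg, s.mem⟩
  | jzS {s : RState w Reg Lab Op} {l : Lab} {r : Reg} {i : BitVec w} :
      s.fetch = some (.jz l r) → s.reg r = 0 → Res s.code l i →
      RStep opSem s .tau ⟨s.code, i, s.reg, s.mem⟩
  | jzF {s : RState w Reg Lab Op} {l : Lab} {r : Reg} :
      s.fetch = some (.jz l r) → s.reg r ≠ 0 →
      RStep opSem s .tau ⟨s.code, s.pc + 1, s.reg, s.mem⟩
  | nop {s : RState w Reg Lab Op} :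
      s.fetch = some .nop →
      RStep opSem s .tau ⟨s.code, s.pc + 1, s.reg, s.mem⟩
  | movek {s : RState w Reg Lab Op} {r : Reg} {k : BitVec w} :
      s.fetch = some (.movek r k) →
      RStep opSem s .tau ⟨s.code, s.pc + 1, Function.update s.reg r k, s.mem⟩
  | mover {s : RState w Reg Lab Op} {r r' : Reg} :
      s.fetch = some (.mover r r') →
      RStep opSem s .tau ⟨s.code, s.pc + 1, Function.update s.reg r (s.reg r'), s.mem⟩
  | op {s : RState w Reg Lab Op} {o : Op} {r r' : Reg} :
      s.fetch = some (.op o r r') →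
      RStep opSem s .tau
        ⟨s.code, s.pc + 1, Function.update s.reg r (opSem o (s.reg r) (s.reg r')), s.mem⟩
  | out {s : RState w Reg Lab Op} {ch : Channel} {r : Reg} :
      s.fetch = some (.out ch r) →
      RStep opSem s (.out ch (s.reg r)) ⟨s.code, s.pc + 1, s.reg, s.mem⟩

theorem Res.unique {w : ℕ} {Reg Lab Op : Type*} {P : Code w Reg Lab Op} {l : Lab}
    {i j : BitVec w} (hi : Res P l i) (hj : Res P l j) : i = j := by
  obtain ⟨I, hI, hIl⟩ := hi
  obtain ⟨J, hJ, hJl⟩ := hj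
  exact BitVec.eq_of_toNat_eq (P.2.lab_unique _ _ I J l hI hJ hIl hJl)

theorem RStep.det {w : ℕ} {Reg Lab Op : Type*} [DecidableEq Reg]
    {opSem : Op → BitVec w → BitVec w → BitVec w} {s s₁ s₂ : RState w Reg Lab Op}
    {a b : Action w} (h₁ : RStep opSem s a s₁) (h₂ : RStep opSem s b s₂) : a = b ∧ s₁ = s₂ := by
  cases h₁ <;> cases h₂ <;> simp_all
  case jmp.jmp => exact Res.unique ‹_› ‹_›
  case jzS.jzS => exact Res.unique ‹_› ‹_›

/-- The bits of the machine.  `CodeLoc` is the set of bits of the code memory; every other storage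
element has one location for each bit of its word. -/
inductive RLoc (w : ℕ) (Reg CodeLoc : Type*)
  | code (c : CodeLoc)
  | pc (i : Fin w)
  | reg (r : Reg) (i : Fin w)
  | mem (p : BitVec w) (i : Fin w)

/-- The parameters of the machine and of the compilation: the levels of variables, registers and
memory cells, the placement `v2p` of the variables in memory, the meaning of the binary operators,
and the binary representation of programs in the code memory. -/
structure Arch (w : ℕ) (Var Reg Lab Op CodeLoc : Type*) where
  varLevel : Var → Level
  regLevel : Reg → Level
  v2p : Var ↪ BitVec w
  cellLevel : BitVec w → Level
  cellLevel_v2p : ∀ x, cellLevel (v2p x) = varLevel x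
  opSem : Op → BitVec w → BitVec w → BitVec w
  encode : Code w Reg Lab Op ↪ (CodeLoc → Bool)

namespace Arch

variable {w : ℕ} {Var Reg Lab Op CodeLoc : Type*}

/-- The assignment of bits to locations that represents a machine state. -/
def bits (A : Arch w Var Reg Lab Op CodeLoc) (s : RState w Reg Lab Op) :
    RLoc w Reg CodeLoc → Bool
  | .code c => A.encode s.code c
  | .pc i => s.pc.getLsbD i
  | .reg r i => (s.reg r).getLsbD i
  | .mem p i => (s.mem p).getLsbD i

theorem bits_injective (A : Arch w Var Reg Lab Op CodeLoc) : Function.Injective A.bits := by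
  rintro ⟨P, pc, R, M⟩ ⟨P', pc', R', M'⟩ h
  have h' := congrFun h
  have hP : P = P' := A.encode.injective (funext fun c => h' (.code c))
  have hpc : pc = pc' := BitVec.eq_of_getLsbD_eq fun i hi => h' (.pc ⟨i, hi⟩)
  have hR : R = R' := funext fun r => BitVec.eq_of_getLsbD_eq fun i hi => h' (.reg r ⟨i, hi⟩)
  have hM : M = M' := funext fun p => BitVec.eq_of_getLsbD_eq fun i hi => h' (.mem p ⟨i, hi⟩)
  subst hP hpc hR hM
  rfl

/-- The RISC machine as a fault-prone system: the faulty locations are the bits of the registers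
and of the data memory, the outputs on the low channel are public, and the transitions are those
of the instruction semantics on the bit representations of machine states. -/
def system [DecidableEq Reg] (A : Arch w Var Reg Lab Op CodeLoc) :
    FaultProneSystem (RLoc w Reg CodeLoc) (Action w) where
  F := {l | (∃ r i, l = .reg r i) ∨ ∃ p i, l = .mem p i}
  tau := .tau
  LAct := {a | ∃ k, a = .out .low k}
  step S a S' := ∃ s s', A.bits s = S ∧ A.bits s' = S' ∧ RStep A.opSem s a s'
  det := by
    rintro S a S₁ b S₂ ⟨s, s₁, rfl, rfl, h₁⟩ ⟨s', s₂, hs, rfl, h₂⟩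
    obtain rfl := A.bits_injective hs
    obtain ⟨rfl, rfl⟩ := h₁.det h₂
    exact ⟨rfl, rfl⟩

/-- The region of data of a given security level. -/
def dataRegion : Level → Region
  | .L => .low
  | .H => .high

/-- The code memory and the program counter form the program part; registers and memory cells are
low or high according to their levels. -/
def region (A : Arch w Var Reg Lab Op CodeLoc) : RLoc w Reg CodeLoc → Region
  | .code _ => .prog
  | .pc _ => .prog
  | .reg r _ => dataRegion (A.regLevel r)
  | .mem p _ => dataRegion (A.cellLevel p)

/-- The program component `(P, k)`: code memory `P` and program counter `k`. -/
def progComp (A : Arch w Var Reg Lab Op CodeLoc) (P : Code w Reg Lab Op) (k : BitVec w) :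
    ProgComp A.region :=
  progOf A.region (A.bits ⟨P, k, fun _ => 0, fun _ => 0⟩)

/-- A RISC program is PoNI if it is so when started at its first instruction. -/
def ProgPoNI [DecidableEq Reg] (A : Arch w Var Reg Lab Op CodeLoc) (P : Code w Reg Lab Op) :
    Prop :=
  A.system.PoNI A.region (A.progComp P 0)

/-- A RISC program is PNI if it is so when started at its first instruction. -/
def ProgPNI [DecidableEq Reg] (A : Arch w Var Reg Lab Op CodeLoc) (P : Code w Reg Lab Op) :
    Prop :=
  FaultProneSystem.PNI.{v} A.system A.region (A.progComp P 0)

end Arch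

/-! ### The source language and the type-directed compilation -/

/-- Expressions of the `while` language. -/
inductive Expr (w : ℕ) (Var Op : Type*)
  | const (k : BitVec w)
  | var (x : Var)
  | op (o : Op) (E₁ E₂ : Expr w Var Op)

/-- Commands of the `while` language. -/
inductive Cmd (w : ℕ) (Var Op : Type*)
  | skip
  | assign (x : Var) (E : Expr w Var Op)
  | ite (E : Expr w Var Op) (C₁ C₂ : Cmd w Var Op)
  | out (ch : Channel) (E : Expr w Var Op)
  | seq (C₁ C₂ : Cmd w Var Op)
  | while (x : Var) (C : Cmd w Var Op)

/-- Register records, as sets of associations between registers and variables.  Starting from the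
empty record, the operations below only produce partial bijections. -/
abbrev RegRec (Reg Var : Type*) := Set (Reg × Var)

/-- `Φ[r ↔ x]`: associate `r` and `x`, after removing all other associations of `r` or `x`. -/
def RegRec.conn {Reg Var : Type*} (Φ : RegRec Reg Var) (r : Reg) (x : Var) : RegRec Reg Var :=
  {a | a ∈ Φ ∧ a.1 ≠ r ∧ a.2 ≠ x} ∪ {(r, x)}

/-- Remove any association of `r`. -/
def RegRec.break {Reg Var : Type*} (Φ : RegRec Reg Var) (r : Reg) : RegRec Reg Var :=
  {a | a ∈ Φ ∧ a.1 ≠ r}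

/-- Write effects: `high` is `wr H`, `any` is the top element. -/
inductive WriteEff
  | high
  | any

def WriteEff.le : WriteEff → WriteEff → Prop
  | .any, .high => False
  | _, _ => True

def WriteEff.sup : WriteEff → WriteEff → WriteEff
  | .high, .high => .high
  | _, _ => .any

/-- The write effect `write(λ)` of a guard level. -/
def Level.write : Level → WriteEff
  | .H => .high
  | .L => .any

/-- Timing annotations `Trm n`, `Trm L`, `Trm H`. -/
inductive Timing
  | exact (n : ℕ)
  | low
  | high

/-- `Trm 0 ⊑ Trm 1 ⊑ … ⊑ Trm L ⊑ Trm H`. -/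
def Timing.le : Timing → Timing → Prop
  | .exact m, .exact n => m ≤ n
  | .exact _, _ => True
  | .low, .exact _ => False
  | .low, _ => True
  | .high, .high => True
  | .high, _ => False

open Classical in
/-- The join that only records whether timing may depend on high data. -/
noncomputable def Timing.join (t₁ t₂ : Timing) : Timing :=
  if t₁.le .low ∧ t₂.le .low then .low else .high

/-- Timing of a sequential composition. -/
noncomputable def Timing.add : Timing → Timing → Timing
  | .exact m, .exact n => .exact (m + n)
  | t₁, t₂ => t₁.join t₂

/-- The timing `term(λ)` of a guard level. -/
def Level.term : Level → Timing
  | .L => .low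
  | .H => .high

section Compilation

variable {w : ℕ} {Var Reg Lab Op CodeLoc : Type*}

/-- Concatenation of code; an empty instruction at the end of the first part passes its label to
the first instruction of the second part. -/
def cat : List (Instr w Reg Lab Op) → List (Instr w Reg Lab Op) → List (Instr w Reg Lab Op)
  | [], Q => Q
  | [⟨l, .eps⟩], ⟨l', B⟩ :: Q => ⟨l.or l', B⟩ :: Q
  | I :: P, Q => I :: cat P Q

/-- `l : P`, the code `P` with the label `l` attached to its first instruction. -/
def labelled (l : Option Lab) (P : List (Instr w Reg Lab Op)) : List (Instr w Reg Lab Op) :=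
  cat [⟨l, .eps⟩] P

/-- A single unlabelled instruction. -/
def instr (B : Body w Reg Lab Op) : List (Instr w Reg Lab Op) := [⟨none, B⟩]

/-- `nopⁿ`; this is the empty sequence when `n = 0`, so that `labelled l (nops 0)` is `[l : ε]`. -/
def nops (n : ℕ) : List (Instr w Reg Lab Op) := List.replicate n ⟨none, .nop⟩

/-- Compilation of expressions: `ExprTyp A Φ X l E P lev n r Φ'` is the judgement
`Φ, X, l ⊩ E ↪ P, ⟨lev, n⟩, r, Φ'`. -/
inductive ExprTyp (A : Arch w Var Reg Lab Op CodeLoc) :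
    RegRec Reg Var → Set Reg → Option Lab → Expr w Var Op → List (Instr w Reg Lab Op) →
    Level → ℕ → Reg → RegRec Reg Var → Prop
  | const {Φ : RegRec Reg Var} {X : Set Reg} {l : Option Lab} {k : BitVec w} {r : Reg} :
      r ∉ X →
      ExprTyp A Φ X l (.const k) [⟨l, .movek r k⟩] (A.regLevel r) 1 r (Φ.break r)
  | cached {Φ : RegRec Reg Var} {X : Set Reg} {l : Option Lab} {x : Var} {r : Reg} :
      (r, x) ∈ Φ →
      ExprTyp A Φ X l (.var x) [⟨l, .eps⟩] (A.regLevel r) 0 r Φ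
  | uncached {Φ : RegRec Reg Var} {X : Set Reg} {l : Option Lab} {x : Var} {r : Reg} :
      r ∉ X → (A.varLevel x).le (A.regLevel r) →
      ExprTyp A Φ X l (.var x) [⟨l, .load r (A.v2p x)⟩] (A.regLevel r) 1 r (Φ.conn r x)
  | op {Φ Φ₁ Φ₂ : RegRec Reg Var} {X : Set Reg} {l : Option Lab} {o : Op}
      {E₁ E₂ : Expr w Var Op} {P₁ P₂ : List (Instr w Reg Lab Op)} {lev : Level} {n₁ n₂ : ℕ}
      {r r' : Reg} :
      ExprTyp A Φ X l E₁ P₁ lev n₁ r Φ₁ →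
      ExprTyp A Φ₁ (X ∪ {r}) none E₂ P₂ lev n₂ r' Φ₂ →
      ExprTyp A Φ X l (.op o E₁ E₂) (cat (cat P₁ P₂) (instr (.op o r r'))) lev (n₁ + n₂ + 1) r
        (Φ₂.break r)

/-- The security annotation of an assignment to, or an output at, level `lev`, when the expression
takes `n` steps. -/
def atomTiming (lev : Level) (n : ℕ) : Timing :=
  match lev with
  | .H => .exact (n + 1)
  | .L => .low

/-- Compilation of commands: `CmdTyp A Φ l C P t e l' Φ' N` is the judgement
`Φ, l ⊢ C ↪ P, ⟨t, e⟩, l', Φ'`, where `N` is the set of the labels that the derivation has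
generated.  That a label is fresh means that it is generated only once in the whole derivation;
this is expressed through the sets `N`. -/
inductive CmdTyp (A : Arch w Var Reg Lab Op CodeLoc) :
    RegRec Reg Var → Option Lab → Cmd w Var Op → List (Instr w Reg Lab Op) →
    Timing → WriteEff → Option Lab → RegRec Reg Var → Set Lab → Prop
  | skip {Φ : RegRec Reg Var} {l : Option Lab} :
      CmdTyp A Φ l .skip [⟨l, .nop⟩] (.exact 1) .high none Φ ∅
  | assign {Φ Φ' : RegRec Reg Var} {l : Option Lab} {x : Var} {E : Expr w Var Op}
      {P : List (Instr w Reg Lab Op)} {n : ℕ} {r : Reg} :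
      ExprTyp A Φ ∅ l E P (A.varLevel x) n r Φ' →
      CmdTyp A Φ l (.assign x E) (cat P (instr (.store (A.v2p x) r)))
        (atomTiming (A.varLevel x) n) (A.varLevel x).write none (Φ'.conn r x) ∅
  | out {Φ Φ' : RegRec Reg Var} {l : Option Lab} {ch : Channel} {E : Expr w Var Op}
      {P : List (Instr w Reg Lab Op)} {n : ℕ} {r : Reg} :
      ExprTyp A Φ ∅ l E P ch.level n r Φ' →
      CmdTyp A Φ l (.out ch E) (cat P (instr (.out ch r)))
        (atomTiming ch.level n) ch.level.write none Φ' ∅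
  | ifAny {Φ Φ₁ Φ₂ Φ₃ : RegRec Reg Var} {l l₁ l₂ : Option Lab} {E : Expr w Var Op}
      {C₁ C₂ : Cmd w Var Op} {P₀ P₁ P₂ : List (Instr w Reg Lab Op)} {lev : Level} {n₀ : ℕ}
      {r : Reg} {t₁ t₂ : Timing} {e₁ e₂ : WriteEff} {br ex : Lab} {N₁ N₂ : Set Lab} :
      ExprTyp A Φ ∅ l E P₀ lev n₀ r Φ₁ →
      CmdTyp A Φ₁ none C₁ P₁ t₁ e₁ l₁ Φ₂ N₁ →
      CmdTyp A Φ₁ none C₂ P₂ t₂ e₂ l₂ Φ₃ N₂ →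
      e₁.le lev.write → e₂.le lev.write →
      Disjoint N₁ N₂ → br ∉ N₁ ∪ N₂ → ex ∉ N₁ ∪ N₂ → br ≠ ex →
      CmdTyp A Φ l (.ite E C₁ C₂)
        (cat P₀ (cat (instr (.jz br r)) (cat P₁ (cat [⟨l₁, .jmp ex⟩]
          (cat (labelled (some br) P₂) [⟨l₂, .nop⟩])))))
        ((lev.term.join t₁).join t₂) lev.write (some ex) (Φ₂ ∩ Φ₃) (N₁ ∪ N₂ ∪ {br, ex})
  | ifHigh {Φ Φ₁ Φ₂ Φ₃ : RegRec Reg Var} {l l₁ l₂ : Option Lab} {E : Expr w Var Op}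
      {C₁ C₂ : Cmd w Var Op} {P₀ P₁ P₂ : List (Instr w Reg Lab Op)} {n₀ n₁ n₂ : ℕ}
      {r : Reg} {br ex : Lab} {N₁ N₂ : Set Lab} :
      ExprTyp A Φ ∅ l E P₀ .H n₀ r Φ₁ →
      CmdTyp A Φ₁ none C₁ P₁ (.exact n₁) .high l₁ Φ₂ N₁ →
      CmdTyp A Φ₁ none C₂ P₂ (.exact n₂) .high l₂ Φ₃ N₂ →
      Disjoint N₁ N₂ → br ∉ N₁ ∪ N₂ → ex ∉ N₁ ∪ N₂ → br ≠ ex →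
      CmdTyp A Φ l (.ite E C₁ C₂)
        (cat P₀ (cat (instr (.jz br r))
          (cat P₁ (cat (labelled l₁ (nops (n₂ - n₁))) (cat (instr (.jmp ex))
          (cat (labelled (some br) P₂) (cat (labelled l₂ (nops (n₁ - n₂))) (instr .nop))))))))
        (.exact (n₀ + max n₁ n₂ + 2)) .high (some ex) (Φ₂ ∩ Φ₃) (N₁ ∪ N₂ ∪ {br, ex})
  | seq {Φ Φ₁ Φ₂ : RegRec Reg Var} {l l₁ l₂ : Option Lab} {C₁ C₂ : Cmd w Var Op}
      {P₁ P₂ : List (Instr w Reg Lab Op)} {t₁ t₂ : Timing} {e₁ e₂ : WriteEff}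
      {N₁ N₂ : Set Lab} :
      CmdTyp A Φ l C₁ P₁ t₁ e₁ l₁ Φ₁ N₁ →
      CmdTyp A Φ₁ l₁ C₂ P₂ t₂ e₂ l₂ Φ₂ N₂ →
      (t₁ = .high → e₂ = .high) →
      Disjoint N₁ N₂ →
      CmdTyp A Φ l (.seq C₁ C₂) (cat P₁ P₂) (t₁.add t₂) (e₁.sup e₂) l₂ Φ₂ (N₁ ∪ N₂)
  | while {Φ ΦB ΦE : RegRec Reg Var} {l l' : Option Lab} {x : Var} {r : Reg}
      {C : Cmd w Var Op} {P : List (Instr w Reg Lab Op)} {lev : Level} {t : Timing}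
      {e : WriteEff} {lp ex : Lab} {N : Set Lab} :
      lev = A.varLevel x → lev = A.regLevel r →
      (t = .high → lev.write = .high) →
      e.le lev.write →
      ΦB ⊆ Φ.conn r x → ΦB ⊆ ΦE.conn r x →
      CmdTyp A ΦB none C P t e l' ΦE N →
      lp ∉ N → ex ∉ N → lp ≠ ex →
      CmdTyp A Φ l (.while x C)
        (cat [⟨l, .load r (A.v2p x)⟩, ⟨none, .store (A.v2p x) r⟩]
          (cat [⟨some lp, .jz ex r⟩] (cat P
          (cat [⟨l', .load r (A.v2p x)⟩, ⟨none, .store (A.v2p x) r⟩] (instr (.jmp lp))))))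
        (lev.term.join t) lev.write (some ex) ΦB (N ∪ {lp, ex})

end Compilation

end FTNI

/-!
Non-interference of compiled code under faults, possibilistic and probabilistic.

The argument has three layers.

*Probabilistic from possibilistic.*  The augmented system has exactly one transition for each state
and fault set, so equality of traces is a bisimulation (`TraceEq.step`).  The probability of a trace
can be computed by recursion, averaging over the fault set of the first step
(`traceProb_cons_eq_tsum_fault`); hence trace-equivalent states have equal trace probabilities.
The recursion needs that distinct kinds of transitions of the composition are never identified,
which holds on the RISC machine: faults make a state stuck only at a conditional jump to a missing
label, where executing the jump moves the program counter and faults do not (`system_clashFree`).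

*From the compiler to a type system for machine code.*  Non-interference does not depend on the
register records: an expression of level `H` touches only registers of level `H`, whatever the
record says.  `SecureCode` keeps what matters, with code as plain concatenations, and
`CmdTyp.secureCode` shows that compiled code is of this form.

*Soundness of that type system.*  Code memory and program counter are not faulty, and equal faults
act in the same way on equal low data.  The properties of positions in the code are stated in
continuation style and indexed by a number `n` of transitions, which lets loops be treated by
induction on `n`:

* `SecureCode.quietAt`: code with write effect `wr H` makes no public output if what follows makes
  none;
* `SecureCode.reachAt`: code with timing `Trm m` arrives at its exit silently after exactly `m`
  transitions, with low data changed only by the faults, so that two runs that branch differently on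
  high data meet again at the same time with the same low data;
* `SecureCode.secureAt`: low-equivalent states at the beginning of the code are indistinguishable if
  those at its exit are, and, for timing `Trm H`, if the exit is silent.

At the end of the program the machine is stuck: the exit label occurs nowhere, as generated labels
are fresh, so jumps to it are stuck as well.  A stuck state only performs silent transitions, so
the last property yields non-interference of the whole program.
-/

namespace FTNI

/-! ### From possibilistic to probabilistic non-interference -/

namespace FaultProneSystem

variable {Loc Act : Type*} {Y : FaultProneSystem Loc Act}

theorem low_eq_of_notMem {a b : Act} (ha : a ∉ Y.LAct) (hb : b ∉ Y.LAct) : Y.low a = Y.low b := by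
  have key : ∀ {c}, c ∉ Y.LAct → Y.low c = ⟨Y.tau, Or.inr rfl⟩ := fun hc => dif_neg hc
  rw [key ha, key hb]

theorem AugStep.total (Y : FaultProneSystem Loc Act) (S : Loc → Bool) (L : Y.FaultSet) :
    ∃ a S', Y.AugStep S L a S' := by
  by_cases hS : Y.Stuck S
  · exact ⟨_, _, .stuck hS⟩
  · by_cases hF : Y.Stuck (flip S L.1)
    · exact ⟨_, _, .madeStuck hS hF⟩
    · simp only [Stuck, not_forall, not_not] at hF
      obtain ⟨a, S', h⟩ := hF
      exact ⟨a, S', .exec hS h⟩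

theorem AugStep.unique {S S₁ S₂ : Loc → Bool} {L : Y.FaultSet} {a b : Act}
    (h₁ : Y.AugStep S L a S₁) (h₂ : Y.AugStep S L b S₂) : a = b ∧ S₁ = S₂ := by
  cases h₁ with
  | exec hS h =>
    cases h₂ with
    | exec _ h' => exact Y.det h h'
    | madeStuck _ hF => exact absurd h (hF _ _)
    | stuck hS' => exact absurd hS' hS
  | madeStuck hS hF =>
    cases h₂ with
    | exec _ h' => exact absurd h' (hF _ _)
    | madeStuck => exact ⟨rfl, rfl⟩
    | stuck hS' => exact absurd hS' hS
  | stuck hS =>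
    cases h₂ with
    | exec hS' => exact absurd hS hS'
    | madeStuck hS' => exact absurd hS hS'
    | stuck => exact ⟨rfl, rfl⟩

theorem hasTrace_cons_iff {S S' : Loc → Bool} {L : Y.FaultSet} {a : Act} {o : Y.Obs}
    {t : List (Y.FaultSet × Y.Obs)} (h : Y.AugStep S L a S') :
    Y.HasTrace S ((L, o) :: t) ↔ o = Y.low a ∧ Y.HasTrace S' t := by
  constructor
  · intro ht
    cases ht with
    | cons h' ht =>
      obtain ⟨rfl, rfl⟩ := h.unique h'
      exact ⟨rfl, ht⟩
  · rintro ⟨rfl, ht⟩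
    exact .cons h ht

/-- Two states are trace equivalent if they have the same possibilistic traces. -/
def TraceEq (Y : FaultProneSystem Loc Act) (S S' : Loc → Bool) : Prop :=
  ∀ t, Y.HasTrace S t ↔ Y.HasTrace S' t

/-- As the augmented system has exactly one transition for each fault set, trace equivalence is a
bisimulation. -/
theorem TraceEq.step {S S' T T' : Loc → Bool} {L : Y.FaultSet} {a b : Act}
    (h : Y.TraceEq S S') (hS : Y.AugStep S L a T) (hS' : Y.AugStep S' L b T') :
    Y.low a = Y.low b ∧ Y.TraceEq T T' := by
  have hab : Y.low a = Y.low b :=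
    ((hasTrace_cons_iff hS').1 ((h _).1 (.cons hS (.nil _)))).1
  refine ⟨hab, fun t => ?_⟩
  have := h ((L, Y.low a) :: t)
  rw [hasTrace_cons_iff hS, hasTrace_cons_iff hS'] at this
  simpa [hab] using this

/-- A system is clash-free if a transition that executes an action never has the same target as
one in which faults make the state stuck.  In the composition with a fault environment, two such
transitions with equal action and probability could not be told apart, so that a sum over runs
would count them only once. -/
def ClashFree (Y : FaultProneSystem Loc Act) : Prop :=
  ∀ (S S' : Loc → Bool) (L L' : Y.FaultSet) (a : Act), ¬ Y.Stuck S → Y.Stuck (flip S L.1) →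
    Y.step (flip S L'.1) a S' → S' ≠ flip S L.1

theorem flip_injective (S : Loc → Bool) : Function.Injective (flip S) := by
  intro L L' h
  ext l
  have := congrFun h l
  by_cases h₁ : l ∈ L <;> by_cases h₂ : l ∈ L' <;> simp_all [flip]

open Classical in
/-- In a clash-free system, the transitions of the composition correspond to the pairs of an
action and a target of the augmented system, and the probability of such a pair is the total
probability of the fault sets that lead to it. -/
theorem compStep_iff (hY : Y.ClashFree) (V : FaultEnv.{v} Y) {S : Loc → Bool} {E : V.State}
    {a : Act} {p : ℝ≥0∞} {Z : (Loc → Bool) × V.State} :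
    CompStep Y V (S, E) a p Z ↔ (∃ L, Y.AugStep S L a Z.1) ∧
      p = ∑' L, (if Y.AugStep S L a Z.1 then V.fault E L else 0) ∧
      Z.2 = V.next E (Y.low a) := by
  have hstep : ∀ {a S'}, ¬ Y.Stuck S → (∃ L : Y.FaultSet, Y.step (flip S L.1) a S') →
      (∑' L : {L : Y.FaultSet // Y.step (flip S L.1) a S'}, V.fault E L.1) =
        ∑' L, (if Y.AugStep S L a S' then V.fault E L else 0) := by
    rintro a S' hS ⟨L₀, h₀⟩
    have := tsum_subtype {L : Y.FaultSet | Y.step (flip S L.1) a S'} (fun L => V.fault E L)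
    refine this.trans (tsum_congr fun L => ?_)
    rw [Set.indicator_apply]
    refine if_congr ⟨fun h => .exec hS h, fun h => ?_⟩ rfl rfl
    cases h with
    | exec _ h => exact h
    | madeStuck _ hF => exact absurd rfl (hY _ _ L L₀ _ hS hF h₀)
    | stuck hS' => exact absurd hS' hS
  have hmade : ∀ {L : Y.FaultSet}, ¬ Y.Stuck S → Y.Stuck (flip S L.1) →
      V.fault E L =
        ∑' L', (if Y.AugStep S L' Y.tau (flip S L.1) then V.fault E L' else 0) := by
    intro L hS hF
    rw [tsum_eq_single L, if_pos (.madeStuck hS hF)]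
    intro L' hL'
    refine if_neg fun h => ?_
    generalize hT : flip S L.1 = T at h
    cases h with
    | exec _ h => exact hY _ _ L L' _ hS hF h hT.symm
    | madeStuck _ _ => exact hL' (Subtype.ext (flip_injective S hT.symm))
    | stuck hS' => exact hS hS'
  have hstuck : Y.Stuck S →
      1 = ∑' L, (if Y.AugStep S L Y.tau S then V.fault E L else 0) := by
    intro hS
    rw [← PMF.tsum_coe (V.fault E)]
    exact tsum_congr fun L => (if_pos (.stuck hS)).symm
  constructor
  · intro h
    cases h with
    | step hS h => exact ⟨h.imp fun L hL => .exec hS hL, hstep hS h, rfl⟩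
    | stuck1 hS hF => exact ⟨⟨_, .madeStuck hS hF⟩, hmade hS hF, rfl⟩
    | stuck2 hS => exact ⟨⟨⟨∅, Set.empty_subset _⟩, .stuck hS⟩, hstuck hS, rfl⟩
  · obtain ⟨S', E'⟩ := Z
    rintro ⟨⟨L, hL⟩, rfl, hE⟩
    dsimp only at hL hE ⊢
    subst hE
    cases hL with
    | exec hS h => exact hstep hS ⟨L, h⟩ ▸ CompStep.step hS ⟨L, h⟩
    | madeStuck hS hF => exact hmade hS hF ▸ CompStep.stuck1 hS hF
    | stuck hS => exact hstuck hS ▸ CompStep.stuck2 hS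

theorem traceProb_nil (V : FaultEnv.{v} Y) (Z : (Loc → Bool) × V.State) :
    traceProb Y V Z [] = 1 := by
  unfold traceProb
  rw [tsum_eq_single ⟨[], .nil Z, rfl⟩]
  · simp
  · rintro ⟨r, hr, h⟩ hne
    exact absurd (Subtype.ext (List.map_eq_nil_iff.1 h)) hne

/-- The trace probability satisfies the expected recursion over the first transition. -/
theorem traceProb_cons (V : FaultEnv.{v} Y) (Z : (Loc → Bool) × V.State) (o : Y.Obs)
    (t : List Y.Obs) :
    traceProb Y V Z (o :: t) =
      ∑' x : {x : Act × ℝ≥0∞ × ((Loc → Bool) × V.State) //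
        CompStep Y V Z x.1 x.2.1 x.2.2 ∧ Y.low x.1 = o},
        x.1.2.1 * traceProb Y V x.1.2.2 t := by
  let φ : (Σ x : {x : Act × ℝ≥0∞ × ((Loc → Bool) × V.State) //
      CompStep Y V Z x.1 x.2.1 x.2.2 ∧ Y.low x.1 = o},
      {r : List (Act × ℝ≥0∞ × ((Loc → Bool) × V.State)) //
        IsRun Y V x.1.2.2 r ∧ r.map (fun x => Y.low x.1) = t}) →
      {r : List (Act × ℝ≥0∞ × ((Loc → Bool) × V.State)) //
        IsRun Y V Z r ∧ r.map (fun x => Y.low x.1) = o :: t} :=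
    fun y => ⟨y.1.1 :: y.2.1, .cons y.1.2.1 y.2.2.1, by simp [y.1.2.2, y.2.2.2]⟩
  have hφ : Function.Bijective φ := by
    constructor
    · rintro ⟨⟨x, hx⟩, r, hr⟩ ⟨⟨x', hx'⟩, r', hr'⟩ h
      simp only [φ, Subtype.mk.injEq, List.cons.injEq] at h
      obtain ⟨rfl, rfl⟩ := h
      rfl
    · rintro ⟨r, hr, h⟩
      cases hr with
      | nil => simp at h
      | cons hs hr =>
        simp only [List.map_cons, List.cons.injEq] at h
        exact ⟨⟨⟨_, hs, h.1⟩, _, hr, h.2⟩, rfl⟩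
  unfold traceProb
  rw [← (Equiv.ofBijective φ hφ).tsum_eq, ENNReal.tsum_sigma']
  refine tsum_congr fun x => ?_
  rw [← ENNReal.tsum_mul_left]
  exact tsum_congr fun r => by simp [φ]

open Classical in
/-- In a clash-free system, the sum over the first transition can be rearranged into a sum over
the fault sets. -/
theorem traceProb_cons_eq_tsum_fault (hY : Y.ClashFree) (V : FaultEnv.{v} Y) (S : Loc → Bool)
    (E : V.State) (o : Y.Obs) (t : List Y.Obs) (act : Y.FaultSet → Act)
    (next : Y.FaultSet → Loc → Bool) (h : ∀ L, Y.AugStep S L (act L) (next L)) :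
    traceProb Y V (S, E) (o :: t) =
      ∑' L, if Y.low (act L) = o then V.fault E L * traceProb Y V (next L, V.next E o) t
        else 0 := by
  rw [traceProb_cons]
  have hx : ∀ x : {x : Act × ℝ≥0∞ × ((Loc → Bool) × V.State) //
      CompStep Y V (S, E) x.1 x.2.1 x.2.2 ∧ Y.low x.1 = o},
      x.1.2.1 * traceProb Y V x.1.2.2 t =
        ∑' L, if Y.AugStep S L x.1.1 x.1.2.2.1 then
          V.fault E L * traceProb Y V x.1.2.2 t else 0 := by
    rintro ⟨⟨a, p, Z⟩, hx, ho⟩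
    replace hx : CompStep Y V (S, E) a p Z := hx
    dsimp only
    conv_lhs => rw [((compStep_iff hY V).1 hx).2.1]
    rw [ ← ENNReal.tsum_mul_right]
    exact tsum_congr fun L => by rw [ite_mul, zero_mul]
  rw [tsum_congr hx, ENNReal.tsum_comm]
  refine tsum_congr fun L => ?_
  split_ifs with ho
  · -- exactly one transition of the composition has the action and target that `L` leads to
    subst ho
    rw [tsum_eq_single ⟨(act L, ∑' L', (if Y.AugStep S L' (act L) (next L) then V.fault E L' else 0),
        (next L, V.next E (Y.low (act L)))),
      (compStep_iff hY V).2 ⟨⟨L, h L⟩, rfl, rfl⟩, rfl⟩]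
    · rw [if_pos (h L)]
    · rintro ⟨⟨a, p, S', E'⟩, hx, hxo⟩ hne
      refine if_neg fun hL => hne (Subtype.ext ?_)
      replace hx : CompStep Y V (S, E) a p (S', E') := hx
      obtain ⟨-, hp, hE⟩ := (compStep_iff hY V).1 hx
      dsimp only at hp hE hL
      obtain ⟨h₁, h₂⟩ := (h L).unique hL
      subst h₁ h₂ hE hp
      rfl
  · rw [ENNReal.tsum_eq_zero]
    rintro ⟨⟨a, p, Z⟩, hx, hxo⟩
    refine if_neg fun hL => ho ?_
    rw [((h L).unique hL).1]
    exact hxo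

theorem TraceEq.traceProb_eq (hY : Y.ClashFree) (V : FaultEnv.{v} Y) (t : List Y.Obs) :
    ∀ {S S' : Loc → Bool} (E : V.State), Y.TraceEq S S' →
      traceProb Y V (S, E) t = traceProb Y V (S', E) t := by
  induction t with
  | nil => intros; rw [traceProb_nil, traceProb_nil]
  | cons o t ih =>
    intro S S' E hS
    choose act next h using fun L => AugStep.total Y S L
    choose act' next' h' using fun L => AugStep.total Y S' L
    rw [traceProb_cons_eq_tsum_fault hY V S E o t act next h,
      traceProb_cons_eq_tsum_fault hY V S' E o t act' next' h']
    refine tsum_congr fun L => ?_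
    obtain ⟨ha, hT⟩ := hS.step (h L) (h' L)
    rw [ha, ih _ hT]

theorem PoNI.pni {region : Loc → Region} {P : ProgComp region} (hY : Y.ClashFree)
    (h : Y.PoNI region P) : PNI.{v} Y region P :=
  fun S S' hS hS' hlow V E t => TraceEq.traceProb_eq hY V t E (h S S' hS hS' hlow)

end FaultProneSystem

/-! ### Faults on the RISC machine -/

namespace Arch

variable {w : ℕ} {Var Reg Lab Op CodeLoc : Type*}
  {A : Arch w Var Reg Lab Op CodeLoc} {Q : Code w Reg Lab Op}

variable (A) in
/-- The machine state that results when faults flip the register and memory bits in `L`. -/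
noncomputable def flipState (L : Set (RLoc w Reg CodeLoc)) (s : RState w Reg Lab Op) : RState w Reg Lab Op where
  code := s.code
  pc := s.pc
  reg r := BitVec.ofFnLE fun i => flip (A.bits s) L (.reg r i)
  mem p := BitVec.ofFnLE fun i => flip (A.bits s) L (.mem p i)

/-- A bit assignment with the program component `(Q, k)` represents a machine state. -/
theorem exists_bits_eq {S : RLoc w Reg CodeLoc → Bool} {k : BitVec w}
    (h : progOf A.region S = A.progComp Q k) :
    ∃ s, A.bits s = S ∧ s.code = Q ∧ s.pc = k := by
  refine ⟨⟨Q, k, fun r => BitVec.ofFnLE fun i => S (.reg r i),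
    fun p => BitVec.ofFnLE fun i => S (.mem p i)⟩, funext fun l => ?_, rfl, rfl⟩
  cases l with
  | code c => exact (congrFun h ⟨.code c, rfl⟩).symm
  | pc i => exact (congrFun h ⟨.pc i, rfl⟩).symm
  | reg r i => simp [bits]
  | mem p i => simp [bits]

variable (A) in
/-- Two machine states agree on the low registers and the low memory cells. -/
def DataEq (s s' : RState w Reg Lab Op) : Prop :=
  (∀ r, A.regLevel r = .L → s.reg r = s'.reg r) ∧ ∀ p, A.cellLevel p = .L → s.mem p = s'.mem p

theorem DataEq.refl (s : RState w Reg Lab Op) : A.DataEq s s := ⟨fun _ _ => rfl, fun _ _ => rfl⟩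

theorem DataEq.symm {s s' : RState w Reg Lab Op} (h : A.DataEq s s') : A.DataEq s' s :=
  ⟨fun r hr => (h.1 r hr).symm, fun p hp => (h.2 p hp).symm⟩

theorem DataEq.trans {s s' s'' : RState w Reg Lab Op} (h : A.DataEq s s')
    (h' : A.DataEq s' s'') : A.DataEq s s'' :=
  ⟨fun r hr => (h.1 r hr).trans (h'.1 r hr), fun p hp => (h.2 p hp).trans (h'.2 p hp)⟩

theorem DataEq.flipState {s s' : RState w Reg Lab Op} (h : A.DataEq s s')
    (L : Set (RLoc w Reg CodeLoc)) : A.DataEq (A.flipState L s) (A.flipState L s') := by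
  constructor
  · intro r hr
    simp [Arch.flipState, flip, bits, h.1 r hr]
  · intro p hp
    simp [Arch.flipState, flip, bits, h.2 p hp]

theorem dataEq_of_lowEq {s s' : RState w Reg Lab Op}
    (h : LowEq A.region (A.bits s) (A.bits s')) : A.DataEq s s' := by
  constructor
  · exact fun r hr => BitVec.eq_of_getLsbD_eq fun i hi =>
      h (.reg r ⟨i, hi⟩) (by simp [region, hr, dataRegion])
  · exact fun p hp => BitVec.eq_of_getLsbD_eq fun i hi =>
      h (.mem p ⟨i, hi⟩) (by simp [region, hp, dataRegion])

/-! ### Code positions -/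

/-- The state `s` runs the code `Q` and is at position `i`. -/
def AtPos (Q : Code w Reg Lab Op) (i : ℕ) (s : RState w Reg Lab Op) : Prop :=
  s.code = Q ∧ s.pc.toNat = i

/-- The instruction at position `i` of `Q` has the body `B`. -/
def HasBody (Q : Code w Reg Lab Op) (i : ℕ) (B : Body w Reg Lab Op) : Prop :=
  ∃ I, Q.1[i]? = some I ∧ I.body = B

/-- The instruction at position `i` of `Q` has the label `l`. -/
def HasLab (Q : Code w Reg Lab Op) (l : Lab) (i : ℕ) : Prop :=
  ∃ I, Q.1[i]? = some I ∧ I.lab = some l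

/-- The label `l` does not occur in `Q`. -/
def NoLab (Q : Code w Reg Lab Op) (l : Lab) : Prop := ∀ i, ¬ HasLab Q l i

theorem AtPos.flipState {i : ℕ} {s : RState w Reg Lab Op} (h : AtPos Q i s)
    (L : Set (RLoc w Reg CodeLoc)) : AtPos Q i (A.flipState L s) := h

theorem HasBody.fetch {i : ℕ} {B : Body w Reg Lab Op} (hB : HasBody Q i B)
    {s : RState w Reg Lab Op} (h : AtPos Q i s) : s.fetch = some B := by
  obtain ⟨I, hI, rfl⟩ := hB
  obtain ⟨rfl, rfl⟩ := h
  simp [RState.fetch, hI]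

theorem toNat_add_one {c : BitVec w} (h : c.toNat + 1 < 2 ^ w) :
    (c + 1).toNat = c.toNat + 1 := by
  have h1 : (1 : BitVec w).toNat = 1 % 2 ^ w := BitVec.toNat_ofNat 1 w
  rw [BitVec.toNat_add, h1, Nat.add_mod_mod, Nat.mod_eq_of_lt h]

theorem AtPos.succ {i : ℕ} {B : Body w Reg Lab Op} (hB : HasBody Q i B)
    {s : RState w Reg Lab Op} (h : AtPos Q i s) (R : Reg → BitVec w)
    (M : BitVec w → BitVec w) : AtPos Q (i + 1) ⟨s.code, s.pc + 1, R, M⟩ := by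
  obtain ⟨I, hI, -⟩ := hB
  have hlt := (List.getElem?_eq_some_iff.1 hI).1
  have hfit := Q.2.fits
  refine ⟨h.1, ?_⟩
  rw [toNat_add_one (by rw [h.2]; omega), h.2]

theorem HasLab.res {l : Lab} {j : ℕ} (h : HasLab Q l j) :
    ∃ k : BitVec w, Res Q l k ∧ k.toNat = j := by
  obtain ⟨I, hI, hl⟩ := h
  have hlt := (List.getElem?_eq_some_iff.1 hI).1
  have hfit := Q.2.fits
  have hj : (BitVec.ofNat w j).toNat = j := by
    rw [BitVec.toNat_ofNat, Nat.mod_eq_of_lt (by omega)]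
  exact ⟨BitVec.ofNat w j, ⟨I, by rw [hj]; exact hI, hl⟩, hj⟩

theorem NoLab.not_res {l : Lab} (h : NoLab Q l) (k : BitVec w) : ¬ Res Q l k :=
  fun ⟨I, hI, hl⟩ => h _ ⟨I, hI, hl⟩

/-! ### Transitions of the augmented machine -/

variable [DecidableEq Reg]

theorem bits_flipState (L : A.system.FaultSet) (s : RState w Reg Lab Op) :
    A.bits (A.flipState L.1 s) = flip (A.bits s) L.1 := by
  funext l
  cases l with
  | code c =>
    have : RLoc.code c ∉ L.1 := fun h => by simpa [system] using L.2 h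
    simp [bits, flipState, flip, this]
  | pc i =>
    have : RLoc.pc i ∉ L.1 := fun h => by simpa [system] using L.2 h
    simp [bits, flipState, flip, this]
  | reg r i => simp [bits, flipState]
  | mem p i => simp [bits, flipState]

variable (A) in
/-- A machine state without a transition. -/
def RStuck (s : RState w Reg Lab Op) : Prop := ∀ a s', ¬ RStep A.opSem s a s'

theorem step_bits_iff {s : RState w Reg Lab Op} {a : Action w} {S' : RLoc w Reg CodeLoc → Bool} :
    A.system.step (A.bits s) a S' ↔ ∃ s', A.bits s' = S' ∧ RStep A.opSem s a s' := by
  constructor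
  · rintro ⟨s₀, s', h, rfl, hs⟩
    obtain rfl := A.bits_injective h
    exact ⟨s', rfl, hs⟩
  · rintro ⟨s', rfl, hs⟩
    exact ⟨s, s', rfl, rfl, hs⟩

theorem stuck_bits_iff {s : RState w Reg Lab Op} :
    A.system.Stuck (A.bits s) ↔ A.RStuck s := by
  constructor
  · exact fun h a s' hs => h a _ (step_bits_iff.2 ⟨s', rfl, hs⟩)
  · intro h a S' hS
    obtain ⟨s', -, hs⟩ := step_bits_iff.1 hS
    exact h a s' hs

variable (A) in
/-- Transitions of the augmented machine, between machine states. -/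
def FaultStep (s : RState w Reg Lab Op) (L : A.system.FaultSet) (a : Action w)
    (s' : RState w Reg Lab Op) : Prop :=
  A.system.AugStep (A.bits s) L a (A.bits s')

theorem faultStep_iff {s s' : RState w Reg Lab Op} {L : A.system.FaultSet} {a : Action w} :
    A.FaultStep s L a s' ↔
      (¬ A.RStuck s ∧ RStep A.opSem (A.flipState L.1 s) a s') ∨
      (¬ A.RStuck s ∧ A.RStuck (A.flipState L.1 s) ∧ a = .tau ∧ s' = A.flipState L.1 s) ∨
      (A.RStuck s ∧ a = .tau ∧ s' = s) := by
  constructor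
  · intro h
    rw [FaultStep] at h
    generalize hT : A.bits s' = T at h
    cases h with
    | exec hS h =>
      rw [← bits_flipState, step_bits_iff] at h
      obtain ⟨u, rfl, hu⟩ := h
      obtain rfl := A.bits_injective hT
      exact .inl ⟨stuck_bits_iff.not.1 hS, hu⟩
    | madeStuck hS hF =>
      rw [← bits_flipState] at hF hT
      exact .inr (.inl ⟨stuck_bits_iff.not.1 hS, stuck_bits_iff.1 hF, rfl,
        A.bits_injective hT⟩)
    | stuck hS =>
      exact .inr (.inr ⟨stuck_bits_iff.1 hS, rfl, A.bits_injective hT⟩)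
  · rintro (⟨hS, h⟩ | ⟨hS, hF, rfl, rfl⟩ | ⟨hS, rfl, rfl⟩)
    · refine .exec (stuck_bits_iff.not.2 hS) ?_
      rw [← bits_flipState]
      exact step_bits_iff.2 ⟨_, rfl, h⟩
    · rw [FaultStep, bits_flipState]
      refine .madeStuck (stuck_bits_iff.not.2 hS) ?_
      rw [← bits_flipState]
      exact stuck_bits_iff.2 hF
    · exact .stuck (stuck_bits_iff.2 hS)

theorem exists_faultStep_of_augStep {s : RState w Reg Lab Op} {L : A.system.FaultSet}
    {a : Action w} {S' : RLoc w Reg CodeLoc → Bool} (h : A.system.AugStep (A.bits s) L a S') :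
    ∃ s', A.bits s' = S' ∧ A.FaultStep s L a s' := by
  have key : ∃ s', A.bits s' = S' := by
    cases h with
    | exec hS h =>
      rw [← bits_flipState, step_bits_iff] at h
      obtain ⟨u, hu, -⟩ := h
      exact ⟨u, hu⟩
    | madeStuck hS hF => exact ⟨_, bits_flipState L s⟩
    | stuck hS => exact ⟨s, rfl⟩
  obtain ⟨s', rfl⟩ := key
  exact ⟨s', rfl, h⟩

/-- Faults make a state stuck only at a conditional jump to a missing label, and then no action
that executes there leaves the program counter unchanged. -/
theorem system_clashFree : A.system.ClashFree := by
  intro S S' L L' a hS hF hstep hS'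
  obtain ⟨s, rfl⟩ : ∃ s, A.bits s = S := by
    simp only [FaultProneSystem.Stuck, not_forall, not_not] at hS
    obtain ⟨_, _, s, _, hs, _⟩ := hS
    exact ⟨s, hs⟩
  rw [← bits_flipState, step_bits_iff] at hstep
  rw [← bits_flipState, stuck_bits_iff] at hF
  obtain ⟨s', rfl, hs⟩ := hstep
  rw [← bits_flipState] at hS'
  obtain rfl := A.bits_injective hS'
  -- the fetched instruction does not depend on the faults; unless it is a conditional jump to a
  -- missing label, it can execute after one fault set if it can after the other
  have hfetch : ∀ B, (A.flipState L'.1 s).fetch = some B → (A.flipState L.1 s).fetch = some B :=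
    fun _ h => h
  have htarget : ∀ {b : Action w} {t : RState w Reg Lab Op},
      RStep A.opSem (A.flipState L'.1 s) b t → t.pc = s.pc → False := by
    intro b t ht hpc
    cases ht with
    | load h => exact hF _ _ (.load (hfetch _ h))
    | store h => exact hF _ _ (.store (hfetch _ h))
    | jmp h hl => exact hF _ _ (.jmp (hfetch _ h) hl)
    | @jzS l r i h h0 hl =>
      by_cases h1 : (A.flipState L.1 s).reg r = 0
      · exact hF _ _ (.jzS (hfetch _ h) h1 hl)
      · exact hF _ _ (.jzF (hfetch _ h) h1)
    | jzF h =>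
      have hlt : s.pc.toNat < s.code.1.length := by
        by_contra hge
        simp [RState.fetch, flipState, List.getElem?_eq_none (not_lt.1 hge)] at h
      have hfit := s.code.2.fits
      have := congrArg BitVec.toNat hpc
      simp only [flipState] at this
      rw [toNat_add_one (by omega)] at this
      omega
    | nop h => exact hF _ _ (.nop (hfetch _ h))
    | movek h => exact hF _ _ (.movek (hfetch _ h))
    | mover h => exact hF _ _ (.mover (hfetch _ h))
    | op h => exact hF _ _ (.op (hfetch _ h))
    | out h => exact hF _ _ (.out (hfetch _ h))
  exact htarget hs rfl

/-! ### Step-indexed indistinguishability -/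

/-- Actions that are not outputs on the low channel. -/
def _root_.FTNI.Action.Silent (a : Action w) : Prop := ∀ k, a ≠ .out .low k

theorem silent_tau : (Action.tau : Action w).Silent := fun _ => nofun

theorem _root_.FTNI.Action.Silent.low_eq {a b : Action w} (ha : a.Silent) (hb : b.Silent) :
    A.system.low a = A.system.low b := by
  have key : ∀ {c : Action w}, c.Silent → c ∉ A.system.LAct := fun hc ⟨k, hk⟩ => hc k hk
  exact FaultProneSystem.low_eq_of_notMem (key ha) (key hb)

variable (A) in
/-- The next `n` transitions from `s` are silent, whatever the faults. -/
def Quiet : ℕ → RState w Reg Lab Op → Prop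
  | 0, _ => True
  | n + 1, s => ∀ L a t, A.FaultStep s L a t → a.Silent ∧ Quiet n t

variable (A) in
/-- For the next `n` transitions, equal faults lead to equal observations from `s` and `s'`. -/
def Indist : ℕ → RState w Reg Lab Op → RState w Reg Lab Op → Prop
  | 0, _, _ => True
  | n + 1, s, s' => ∀ L a b t t', A.FaultStep s L a t → A.FaultStep s' L b t' →
      A.system.low a = A.system.low b ∧ Indist n t t'

theorem Quiet.mono {m n : ℕ} (hmn : m ≤ n) {s : RState w Reg Lab Op} (h : A.Quiet n s) :
    A.Quiet m s := by
  induction m generalizing n s with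
  | zero => trivial
  | succ m ih =>
    obtain ⟨n, rfl⟩ : ∃ k, n = k + 1 := ⟨n - 1, by omega⟩
    exact fun L a t hs => (h L a t hs).imp_right (ih (by omega))

theorem Indist.mono {m n : ℕ} (hmn : m ≤ n) {s s' : RState w Reg Lab Op} (h : A.Indist n s s') :
    A.Indist m s s' := by
  induction m generalizing n s s' with
  | zero => trivial
  | succ m ih =>
    obtain ⟨n, rfl⟩ : ∃ k, n = k + 1 := ⟨n - 1, by omega⟩
    exact fun L a b t t' hs hs' => (h L a b t t' hs hs').imp_right (ih (by omega))

theorem Quiet.indist {n : ℕ} {s s' : RState w Reg Lab Op} (h : A.Quiet n s)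
    (h' : A.Quiet n s') : A.Indist n s s' := by
  induction n generalizing s s' with
  | zero => trivial
  | succ n ih =>
    intro L a b t t' hs hs'
    exact ⟨(h L a t hs).1.low_eq (h' L b t' hs').1, ih (h L a t hs).2 (h' L b t' hs').2⟩

theorem RStuck.quiet {s : RState w Reg Lab Op} (h : A.RStuck s) (n : ℕ) : A.Quiet n s := by
  induction n with
  | zero => trivial
  | succ n ih =>
    intro L a t hs
    obtain ⟨hS, -⟩ | ⟨hS, -⟩ | ⟨-, rfl, rfl⟩ := faultStep_iff.1 hs
    · exact absurd h hS
    · exact absurd h hS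
    · exact ⟨silent_tau, ih⟩

theorem Indist.hasTrace {t : List (A.system.FaultSet × A.system.Obs)}
    {s s' : RState w Reg Lab Op} (h : A.Indist t.length s s')
    (ht : A.system.HasTrace (A.bits s) t) : A.system.HasTrace (A.bits s') t := by
  induction t generalizing s s' with
  | nil => exact .nil _
  | cons x t ih =>
    obtain ⟨L, o⟩ := x
    cases ht with
    | cons hS ht =>
      obtain ⟨u, rfl, hu⟩ := exists_faultStep_of_augStep hS
      obtain ⟨b, _, hS'⟩ := FaultProneSystem.AugStep.total A.system (A.bits s') L
      obtain ⟨u', rfl, hu'⟩ := exists_faultStep_of_augStep hS'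
      obtain ⟨hab, hi⟩ := h L _ _ _ _ hu hu'
      rw [hab]
      exact .cons hS' (ih hi ht)

theorem rStuck_of_length {s : RState w Reg Lab Op} (h : AtPos Q Q.1.length s) : A.RStuck s := by
  have hf : s.fetch = none := by simp [RState.fetch, h.1, h.2]
  intro a s' hs
  cases hs <;> simp_all

/-! ### Straight-line instructions -/

variable (A) in
/-- The effect of an instruction other than a jump, `none` for jumps and the empty instruction. -/
def exec (s : RState w Reg Lab Op) : Body w Reg Lab Op → Option (Action w × RState w Reg Lab Op)
  | .load r p => some (.tau, ⟨s.code, s.pc + 1, Function.update s.reg r (s.mem p), s.mem⟩)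
  | .store p r => some (.tau, ⟨s.code, s.pc + 1, s.reg, Function.update s.mem p (s.reg r)⟩)
  | .nop => some (.tau, ⟨s.code, s.pc + 1, s.reg, s.mem⟩)
  | .movek r k => some (.tau, ⟨s.code, s.pc + 1, Function.update s.reg r k, s.mem⟩)
  | .mover r r' => some (.tau, ⟨s.code, s.pc + 1, Function.update s.reg r (s.reg r'), s.mem⟩)
  | .op o r r' => some (.tau,
      ⟨s.code, s.pc + 1, Function.update s.reg r (A.opSem o (s.reg r) (s.reg r')), s.mem⟩)
  | .out ch r => some (.out ch (s.reg r), ⟨s.code, s.pc + 1, s.reg, s.mem⟩)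
  | _ => none

variable (A) in
/-- Instructions other than jumps that do not leak high data into low registers, low memory cells
or the low channel. -/
def SecureBody : Body w Reg Lab Op → Prop
  | .load r p => (A.cellLevel p).le (A.regLevel r)
  | .store p r => (A.regLevel r).le (A.cellLevel p)
  | .nop => True
  | .movek _ _ => True
  | .mover r r' => (A.regLevel r').le (A.regLevel r)
  | .op _ r r' => (A.regLevel r').le (A.regLevel r)
  | .out ch r => (A.regLevel r).le ch.level
  | _ => False

variable (A) in
/-- Instructions other than jumps that affect only high registers, high memory cells and the high
channel. -/
def HighBody : Body w Reg Lab Op → Prop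
  | .load r _ => A.regLevel r = .H
  | .store p _ => A.cellLevel p = .H
  | .nop => True
  | .movek r _ => A.regLevel r = .H
  | .mover r _ => A.regLevel r = .H
  | .op _ r _ => A.regLevel r = .H
  | .out ch _ => ch = .high
  | _ => False

theorem SecureBody.isSome_exec {B : Body w Reg Lab Op} (h : A.SecureBody B)
    (s : RState w Reg Lab Op) : (A.exec s B).isSome := by
  cases B <;> first | rfl | exact h.elim

theorem HighBody.isSome_exec {B : Body w Reg Lab Op} (h : A.HighBody B)
    (s : RState w Reg Lab Op) : (A.exec s B).isSome := by
  cases B <;> first | rfl | exact h.elim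

theorem rStep_of_exec {s t : RState w Reg Lab Op} {a : Action w} {B : Body w Reg Lab Op}
    (hf : s.fetch = some B) (h : A.exec s B = some (a, t)) : RStep A.opSem s a t := by
  cases B <;> simp only [exec, Option.some.injEq, Prod.mk.injEq, reduceCtorEq] at h <;>
    obtain ⟨rfl, rfl⟩ := h
  · exact .load hf
  · exact .store hf
  · exact .nop hf
  · exact .movek hf
  · exact .mover hf
  · exact .op hf
  · exact .out hf

theorem exec_succ {i : ℕ} {s t : RState w Reg Lab Op} {a : Action w} {B : Body w Reg Lab Op}
    (hB : HasBody Q i B) (hs : AtPos Q i s) (h : A.exec s B = some (a, t)) :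
    AtPos Q (i + 1) t := by
  cases B <;> simp only [exec, Option.some.injEq, Prod.mk.injEq, reduceCtorEq] at h <;>
    obtain ⟨rfl, rfl⟩ := h <;> exact hs.succ hB _ _

theorem FaultStep.exec {i : ℕ} {s t : RState w Reg Lab Op} {L : A.system.FaultSet} {a : Action w}
    {B : Body w Reg Lab Op} (hB : HasBody Q i B) (hs : AtPos Q i s)
    (hx : ∀ u, (A.exec u B).isSome) (h : A.FaultStep s L a t) :
    A.exec (A.flipState L.1 s) B = some (a, t) ∧ AtPos Q (i + 1) t := by
  have key : ∀ u, AtPos Q i u → ∃ b v, A.exec u B = some (b, v) ∧ RStep A.opSem u b v := by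
    intro u hu
    obtain ⟨⟨b, v⟩, hv⟩ := Option.isSome_iff_exists.1 (hx u)
    exact ⟨b, v, hv, rStep_of_exec (hB.fetch hu) hv⟩
  obtain ⟨b, v, hv, hstep⟩ := key _ (hs.flipState (A := A) L.1)
  obtain ⟨-, h'⟩ | ⟨-, hF, -⟩ | ⟨hS, -⟩ := faultStep_iff.1 h
  · obtain ⟨rfl, rfl⟩ := hstep.det h'
    exact ⟨hv, exec_succ hB (hs.flipState (A := A) L.1) hv⟩
  · exact absurd hstep (hF _ _)
  · obtain ⟨b', v', -, hstep'⟩ := key s hs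
    exact absurd hstep' (hS _ _)

theorem HighBody.exec_dataEq {s t : RState w Reg Lab Op} {a : Action w} {B : Body w Reg Lab Op}
    (hB : A.HighBody B) (h : A.exec s B = some (a, t)) : a.Silent ∧ A.DataEq t s := by
  have hreg : ∀ (r : Reg) (k : BitVec w) (c : BitVec w), A.regLevel r = .H →
      A.DataEq ⟨s.code, c, Function.update s.reg r k, s.mem⟩ s := by
    refine fun r k c hr => ⟨fun r' hr' => Function.update_of_ne ?_ _ _, fun _ _ => rfl⟩
    rintro rfl
    simp [hr] at hr'
  cases B <;> simp only [exec, Option.some.injEq, Prod.mk.injEq, reduceCtorEq] at h <;>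
    obtain ⟨rfl, rfl⟩ := h
  · exact ⟨silent_tau, hreg _ _ _ hB⟩
  · refine ⟨silent_tau, fun _ _ => rfl, fun p hp => Function.update_of_ne ?_ _ _⟩
    rintro rfl
    simp [HighBody, hp] at hB
  · exact ⟨silent_tau, .refl s⟩
  · exact ⟨silent_tau, hreg _ _ _ hB⟩
  · exact ⟨silent_tau, hreg _ _ _ hB⟩
  · exact ⟨silent_tau, hreg _ _ _ hB⟩
  · refine ⟨fun k hk => ?_, .refl s⟩
    simp only [HighBody] at hB
    simp [hB] at hk

theorem _root_.FTNI.Level.le.eq_low {l l' : Level} (h : l.le l') (h' : l' = .L) : l = .L := by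
  cases l <;> simp_all [Level.le]

theorem SecureBody.exec_dataEq {s s' t t' : RState w Reg Lab Op} {a b : Action w}
    {B : Body w Reg Lab Op} (hB : A.SecureBody B) (hs : A.DataEq s s')
    (h : A.exec s B = some (a, t)) (h' : A.exec s' B = some (b, t')) :
    A.system.low a = A.system.low b ∧ A.DataEq t t' := by
  have hreg : ∀ (r : Reg) (k k' c c' : BitVec w), (A.regLevel r = .L → k = k') →
      A.DataEq ⟨s.code, c, Function.update s.reg r k, s.mem⟩
        ⟨s'.code, c', Function.update s'.reg r k', s'.mem⟩ := by
    refine fun r k k' c c' hr => ⟨fun r' hr' => ?_, hs.2⟩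
    by_cases hrr : r' = r
    · subst hrr
      simp [hr hr']
    · simp [hrr, hs.1 r' hr']
  cases B <;> simp only [exec, Option.some.injEq, Prod.mk.injEq, reduceCtorEq] at h h' <;>
    obtain ⟨rfl, rfl⟩ := h <;> obtain ⟨rfl, rfl⟩ := h'
  · exact ⟨rfl, hreg _ _ _ _ _ fun hr => hs.2 _ (hB.eq_low hr)⟩
  · refine ⟨rfl, hs.1, fun p hp => ?_⟩
    simp only [Function.update_apply]
    split_ifs with hpp
    · subst hpp
      exact hs.1 _ (hB.eq_low hp)
    · exact hs.2 p hp
  · exact ⟨rfl, hs⟩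
  · exact ⟨rfl, hreg _ _ _ _ _ fun _ => rfl⟩
  · exact ⟨rfl, hreg _ _ _ _ _ fun hr => hs.1 _ (hB.eq_low hr)⟩
  · refine ⟨rfl, hreg _ _ _ _ _ fun hr => ?_⟩
    rw [hs.1 _ hr, hs.1 _ (hB.eq_low hr)]
  · rename_i ch r
    refine ⟨?_, hs⟩
    cases ch with
    | low => rw [hs.1 r (hB.eq_low rfl)]
    | high => exact Action.Silent.low_eq (fun _ => nofun) (fun _ => nofun)

/-! ### Security properties of code positions -/

variable (A) in
/-- Every state at position `i` is quiet for `n` transitions. -/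
def QuietAt (Q : Code w Reg Lab Op) (n i : ℕ) : Prop := ∀ s, AtPos Q i s → A.Quiet n s

variable (A) in
/-- Any two low-equivalent states at position `i` are indistinguishable for `n` transitions. -/
def SecureAt (Q : Code w Reg Lab Op) (n i : ℕ) : Prop :=
  ∀ s s', AtPos Q i s → AtPos Q i s' → A.DataEq s s' → A.Indist n s s'

variable (A) in
/-- Whatever the faults, the state is at position `j` after exactly `m` transitions, all of which
are silent and change low data only by the faults. -/
def Reach (Q : Code w Reg Lab Op) : ℕ → RState w Reg Lab Op → ℕ → Prop
  | 0, s, j => AtPos Q j s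
  | m + 1, s, j => ∀ L a t, A.FaultStep s L a t →
      a.Silent ∧ A.DataEq t (A.flipState L.1 s) ∧ Reach Q m t j

variable (A) in
/-- Every state at position `i` reaches position `j` silently in exactly `m` transitions. -/
def ReachAt (Q : Code w Reg Lab Op) (m i j : ℕ) : Prop := ∀ s, AtPos Q i s → A.Reach Q m s j

theorem QuietAt.mono {m n i : ℕ} (h : A.QuietAt Q n i) (hmn : m ≤ n) : A.QuietAt Q m i :=
  fun s hs => (h s hs).mono hmn

theorem SecureAt.mono {m n i : ℕ} (h : A.SecureAt Q n i) (hmn : m ≤ n) : A.SecureAt Q m i :=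
  fun s s' hs hs' hd => (h s s' hs hs' hd).mono hmn

theorem QuietAt.secureAt {n i : ℕ} (h : A.QuietAt Q n i) : A.SecureAt Q n i :=
  fun s s' hs hs' _ => (h s hs).indist (h s' hs')

theorem quietAt_length (n : ℕ) : A.QuietAt Q n Q.1.length :=
  fun _ hs => (rStuck_of_length hs).quiet n

theorem Reach.trans {m m' j k : ℕ} {s : RState w Reg Lab Op} (h : A.Reach Q m s j)
    (h' : A.ReachAt Q m' j k) : A.Reach Q (m + m') s k := by
  induction m generalizing s with
  | zero => rw [Nat.zero_add]; exact h' s h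
  | succ m ih =>
    rw [Nat.add_right_comm]
    intro L a t hs
    obtain ⟨h₁, h₂, h₃⟩ := h L a t hs
    exact ⟨h₁, h₂, ih h₃⟩

theorem ReachAt.trans {m m' i j k : ℕ} (h : A.ReachAt Q m i j) (h' : A.ReachAt Q m' j k) :
    A.ReachAt Q (m + m') i k := fun s hs => (h s hs).trans h'

theorem Reach.quiet {m n j : ℕ} {s : RState w Reg Lab Op} (h : A.Reach Q m s j)
    (hj : A.QuietAt Q n j) : A.Quiet (m + n) s := by
  induction m generalizing s with
  | zero => rw [Nat.zero_add]; exact hj s h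
  | succ m ih =>
    rw [Nat.add_right_comm]
    intro L a t hs
    obtain ⟨h₁, -, h₃⟩ := h L a t hs
    exact ⟨h₁, ih h₃⟩

/-- Two low-equivalent states that silently reach the same position in the same number of
transitions are still low-equivalent there, as equal faults act on low data in the same way. -/
theorem Reach.indist {m n j : ℕ} {s s' : RState w Reg Lab Op} (h : A.Reach Q m s j)
    (h' : A.Reach Q m s' j) (hd : A.DataEq s s') (hj : A.SecureAt Q n j) :
    A.Indist (m + n) s s' := by
  induction m generalizing s s' with
  | zero => rw [Nat.zero_add]; exact hj s s' h h' hd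
  | succ m ih =>
    rw [Nat.add_right_comm]
    intro L a b t t' hs hs'
    obtain ⟨h₁, h₂, h₃⟩ := h L a t hs
    obtain ⟨h₁', h₂', h₃'⟩ := h' L b t' hs'
    exact ⟨h₁.low_eq h₁', ih h₃ h₃' (h₂.trans ((hd.flipState L.1).trans h₂'.symm))⟩

theorem ReachAt.quietAt {m n i j : ℕ} (h : A.ReachAt Q m i j) (hj : A.QuietAt Q n j) :
    A.QuietAt Q n i := fun s hs => ((h s hs).quiet hj).mono (by omega)

theorem ReachAt.secureAt {m n i j : ℕ} (h : A.ReachAt Q m i j) (hj : A.SecureAt Q n j) :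
    A.SecureAt Q n i :=
  fun s s' hs hs' hd => ((h s hs).indist (h s' hs') hd hj).mono (by omega)

theorem HighBody.reachAt {i : ℕ} {B : Body w Reg Lab Op} (h : A.HighBody B)
    (hB : HasBody Q i B) : A.ReachAt Q 1 i (i + 1) := by
  intro s hs L a t hst
  obtain ⟨hx, ht⟩ := hst.exec hB hs h.isSome_exec
  exact ⟨(h.exec_dataEq hx).1, (h.exec_dataEq hx).2, ht⟩

theorem SecureBody.secureAt {n i : ℕ} {B : Body w Reg Lab Op} (h : A.SecureBody B)
    (hB : HasBody Q i B) (hn : A.SecureAt Q n (i + 1)) : A.SecureAt Q n i := by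
  suffices A.SecureAt Q (n + 1) i from this.mono (by omega)
  intro s s' hs hs' hd L a b t t' hst hst'
  obtain ⟨hx, ht⟩ := hst.exec hB hs h.isSome_exec
  obtain ⟨hx', ht'⟩ := hst'.exec hB hs' h.isSome_exec
  obtain ⟨hab, hd'⟩ := h.exec_dataEq (hd.flipState L.1) hx hx'
  exact ⟨hab, hn t t' ht ht' hd'⟩

/-! ### Jumps -/

/-- The label `l` is attached to position `j`, or `j` is the end of the code and `l` does not
occur at all. -/
def Target (Q : Code w Reg Lab Op) (l : Lab) (j : ℕ) : Prop :=
  HasLab Q l j ∨ j = Q.1.length ∧ NoLab Q l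

theorem reachAt_jmp {i j : ℕ} {l : Lab} (hB : HasBody Q i (.jmp l)) (hl : HasLab Q l j) :
    A.ReachAt Q 1 i j := by
  obtain ⟨k, hk, rfl⟩ := hl.res
  have key : ∀ u : RState w Reg Lab Op, AtPos Q i u →
      RStep A.opSem u .tau ⟨u.code, k, u.reg, u.mem⟩ :=
    fun u hu => .jmp (hB.fetch hu) (hu.1 ▸ hk)
  intro s hs L a t hst
  have hF := key _ (hs.flipState (A := A) L.1)
  obtain ⟨-, h⟩ | ⟨-, h, -⟩ | ⟨h, -⟩ := faultStep_iff.1 hst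
  · obtain ⟨rfl, rfl⟩ := hF.det h
    exact ⟨silent_tau, .refl _, hs.1, rfl⟩
  · exact absurd hF (h _ _)
  · exact absurd (key s hs) (h _ _)

theorem quietAt_jmp_of_noLab {i : ℕ} {l : Lab} (hB : HasBody Q i (.jmp l)) (hl : NoLab Q l)
    (n : ℕ) : A.QuietAt Q n i := by
  intro s hs
  refine RStuck.quiet (fun a s' h => ?_) n
  have hf := hB.fetch hs
  cases h with
  | jmp hf' hres =>
    simp only [hf, Option.some.injEq, Body.jmp.injEq] at hf'
    subst hf'
    exact hl.not_res _ (hs.1 ▸ hres)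
  | _ => simp_all

theorem quietAt_jmp {n i j : ℕ} {l : Lab} (hB : HasBody Q i (.jmp l)) (hl : Target Q l j)
    (hj : A.QuietAt Q n j) : A.QuietAt Q n i :=
  hl.elim (fun h => (reachAt_jmp hB h).quietAt hj) fun h => quietAt_jmp_of_noLab hB h.2 n

theorem secureAt_jmp {n i j : ℕ} {l : Lab} (hB : HasBody Q i (.jmp l)) (hl : Target Q l j)
    (hj : A.SecureAt Q n j) : A.SecureAt Q n i :=
  hl.elim (fun h => (reachAt_jmp hB h).secureAt hj)
    fun h => (quietAt_jmp_of_noLab hB h.2 n).secureAt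

theorem rStuck_jz_iff {i : ℕ} {l : Lab} {r : Reg} (hB : HasBody Q i (.jz l r))
    {s : RState w Reg Lab Op} (hs : AtPos Q i s) :
    A.RStuck s ↔ s.reg r = 0 ∧ NoLab Q l := by
  have hf := hB.fetch hs
  constructor
  · intro h
    by_cases h0 : s.reg r = 0
    · refine ⟨h0, fun j hj => ?_⟩
      obtain ⟨k, hk, -⟩ := hj.res
      exact h _ _ (.jzS hf h0 (hs.1 ▸ hk))
    · exact absurd (.jzF hf h0) (h _ _)
  · rintro ⟨h0, hl⟩ a s' h
    cases h with
    | jzS hf' _ hres =>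
      simp only [hf, Option.some.injEq, Body.jz.injEq] at hf'
      obtain ⟨rfl, rfl⟩ := hf'
      exact hl.not_res _ (hs.1 ▸ hres)
    | jzF hf' h1 =>
      simp only [hf, Option.some.injEq, Body.jz.injEq] at hf'
      obtain ⟨rfl, rfl⟩ := hf'
      exact h1 h0
    | _ => simp_all

/-- The transitions at a conditional jump: the state is or becomes stuck, or control passes to the
label or to the next instruction, depending on the register after the faults. -/
theorem FaultStep.jz {i j : ℕ} {l : Lab} {r : Reg} (hB : HasBody Q i (.jz l r))
    (hl : Target Q l j) {s t : RState w Reg Lab Op} (hs : AtPos Q i s)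
    {L : A.system.FaultSet} {a : Action w} (h : A.FaultStep s L a t) :
    a = .tau ∧
      ((s.reg r = 0 ∧ NoLab Q l ∧ A.RStuck t) ∨
      (¬ (s.reg r = 0 ∧ NoLab Q l) ∧ A.DataEq t (A.flipState L.1 s) ∧
        (((A.flipState L.1 s).reg r = 0 ∧ NoLab Q l ∧ A.RStuck t) ∨
        ((A.flipState L.1 s).reg r = 0 ∧ ¬ NoLab Q l ∧ AtPos Q j t) ∨
        ((A.flipState L.1 s).reg r ≠ 0 ∧ AtPos Q (i + 1) t)))) := by
  have hsF : AtPos Q i (A.flipState L.1 s) := hs.flipState L.1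
  have hfF := hB.fetch hsF
  obtain ⟨hS, h'⟩ | ⟨hS, hF, rfl, rfl⟩ | ⟨hS, rfl, rfl⟩ := faultStep_iff.1 h
  · rw [rStuck_jz_iff hB hs] at hS
    by_cases h0 : (A.flipState L.1 s).reg r = 0
    · obtain hl | ⟨-, hl⟩ := hl
      · obtain ⟨k, hk, rfl⟩ := hl.res
        obtain ⟨rfl, rfl⟩ := RStep.det (.jzS hfF h0 (hsF.1 ▸ hk)) h'
        exact ⟨rfl, .inr ⟨hS, .refl _, .inr (.inl ⟨h0, fun hn => hn _ hl, hs.1, rfl⟩)⟩⟩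
      · exact absurd h' (((rStuck_jz_iff hB hsF).2 ⟨h0, hl⟩) _ _)
    · obtain ⟨rfl, rfl⟩ := RStep.det (.jzF hfF h0) h'
      exact ⟨rfl, .inr ⟨hS, .refl _, .inr (.inr ⟨h0, hsF.succ hB _ _⟩)⟩⟩
  · rw [rStuck_jz_iff hB hs] at hS
    obtain ⟨h0, hn⟩ := (rStuck_jz_iff hB hsF).1 hF
    exact ⟨rfl, .inr ⟨hS, .refl _, .inl ⟨h0, hn, hF⟩⟩⟩
  · obtain ⟨h0, hn⟩ := (rStuck_jz_iff hB hs).1 hS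
    exact ⟨rfl, .inl ⟨h0, hn, hS⟩⟩

theorem quietAt_jz {n i j : ℕ} {l : Lab} {r : Reg} (hB : HasBody Q i (.jz l r))
    (hl : Target Q l j) (hj : A.QuietAt Q n j) (hi : A.QuietAt Q n (i + 1)) :
    A.QuietAt Q (n + 1) i := by
  intro s hs L a t hst
  obtain ⟨rfl, ⟨-, -, h⟩ | ⟨-, -, ⟨-, -, h⟩ | ⟨-, -, h⟩ | ⟨-, h⟩⟩⟩ := hst.jz hB hl hs
  · exact ⟨silent_tau, h.quiet n⟩
  · exact ⟨silent_tau, h.quiet n⟩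
  · exact ⟨silent_tau, hj t h⟩
  · exact ⟨silent_tau, hi t h⟩

/-- A conditional jump on a low register takes the same branch in low-equivalent states. -/
theorem secureAt_jz {n i j : ℕ} {l : Lab} {r : Reg} (hB : HasBody Q i (.jz l r))
    (hl : Target Q l j) (hr : A.regLevel r = .L) (hj : A.SecureAt Q n j)
    (hi : A.SecureAt Q n (i + 1)) : A.SecureAt Q (n + 1) i := by
  intro s s' hs hs' hd L a b t t' hst hst'
  have h0 : s.reg r = s'.reg r := hd.1 r hr
  have hF : (A.flipState L.1 s).reg r = (A.flipState L.1 s').reg r := (hd.flipState L.1).1 r hr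
  have hD : A.DataEq t (A.flipState L.1 s) → A.DataEq t' (A.flipState L.1 s') → A.DataEq t t' :=
    fun h h' => h.trans ((hd.flipState L.1).trans h'.symm)
  obtain ⟨rfl, h⟩ := hst.jz hB hl hs
  obtain ⟨rfl, h'⟩ := hst'.jz hB hl hs'
  refine ⟨rfl, ?_⟩
  rw [← h0, ← hF] at h'
  obtain ⟨h1, h2, h⟩ | ⟨h1, h2, h⟩ := h <;> obtain ⟨h1', h2', h'⟩ | ⟨h1', h2', h'⟩ := h'
  · exact (h.quiet n).indist (h'.quiet n)
  · exact absurd ⟨h1, h2⟩ h1'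
  · exact absurd ⟨h1', h2'⟩ h1
  · have hd' := hD h2 h2'
    obtain ⟨h3, h4, h⟩ | ⟨h3, h4, h⟩ | ⟨h3, h⟩ := h <;>
      obtain ⟨h3', h4', h'⟩ | ⟨h3', h4', h'⟩ | ⟨h3', h'⟩ := h'
    · exact (h.quiet n).indist (h'.quiet n)
    · exact absurd h4 h4'
    · exact absurd h3 h3'
    · exact absurd h4' h4
    · exact hj t t' h h' hd'
    · exact absurd h3 h3'
    · exact absurd h3' h3
    · exact absurd h3' h3
    · exact hi t t' h h' hd'

theorem reachAt_jz {m i j k : ℕ} {l : Lab} {r : Reg} (hB : HasBody Q i (.jz l r))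
    (hl : HasLab Q l j) (hj : A.ReachAt Q m j k) (hi : A.ReachAt Q m (i + 1) k) :
    A.ReachAt Q (m + 1) i k := by
  have hn : ¬ NoLab Q l := fun h => h _ hl
  intro s hs L a t hst
  obtain ⟨rfl, ⟨-, h, -⟩ | ⟨-, hd, ⟨-, h, -⟩ | ⟨-, -, h⟩ | ⟨-, h⟩⟩⟩ := hst.jz hB (.inl hl) hs
  · exact absurd h hn
  · exact absurd h hn
  · exact ⟨silent_tau, hd, hj t h⟩
  · exact ⟨silent_tau, hd, hi t h⟩

end Arch

/-! ### Shape of the compiled code -/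

section Shape

variable {w : ℕ} {Var Reg Lab Op CodeLoc : Type*} {A : Arch w Var Reg Lab Op CodeLoc}

/-- Replace the label of the first instruction. -/
def relabel (l : Option Lab) : List (Instr w Reg Lab Op) → List (Instr w Reg Lab Op)
  | [] => []
  | ⟨_, B⟩ :: T => ⟨l, B⟩ :: T

/-- Unlabelled code with the given instruction bodies. -/
def block (Bs : List (Body w Reg Lab Op)) : List (Instr w Reg Lab Op) := Bs.map (Instr.mk none)

/-- The code contains no empty instruction. -/
def NoEps (P : List (Instr w Reg Lab Op)) : Prop := ∀ I ∈ P, I.body ≠ Body.eps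

theorem noEps_cons {I : Instr w Reg Lab Op} {P : List (Instr w Reg Lab Op)} :
    NoEps (I :: P) ↔ I.body ≠ .eps ∧ NoEps P := List.forall_mem_cons

theorem noEps_append {P P' : List (Instr w Reg Lab Op)} :
    NoEps (P ++ P') ↔ NoEps P ∧ NoEps P' := List.forall_mem_append

theorem NoEps.relabel {P : List (Instr w Reg Lab Op)} (h : NoEps P) (l : Option Lab) :
    NoEps (relabel l P) := by
  cases P with
  | nil => exact h
  | cons I P => exact noEps_cons.2 ⟨(noEps_cons.1 h).1, (noEps_cons.1 h).2⟩

theorem noEps_block_of_secure {Bs : List (Body w Reg Lab Op)} (h : ∀ B ∈ Bs, A.SecureBody B) :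
    NoEps (block Bs) := by
  simp only [NoEps, block, List.mem_map, forall_exists_index, and_imp, forall_apply_eq_imp_iff₂]
  rintro B hB rfl
  exact h _ hB

theorem block_append (Bs Bs' : List (Body w Reg Lab Op)) :
    block (Bs ++ Bs') = block Bs ++ block Bs' := List.map_append

theorem length_block (Bs : List (Body w Reg Lab Op)) : (block Bs).length = Bs.length :=
  List.length_map _

theorem nops_eq_block (k : ℕ) :
    (nops k : List (Instr w Reg Lab Op)) = block (List.replicate k .nop) := by
  simp [nops, block]

theorem noEps_nops (k : ℕ) : NoEps (nops k : List (Instr w Reg Lab Op)) := by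
  intro I hI
  rw [List.eq_of_mem_replicate hI]
  nofun

theorem cat_cons {I : Instr w Reg Lab Op} (hI : I.body ≠ .eps) (P R : List (Instr w Reg Lab Op)) :
    cat (I :: P) R = I :: cat P R := by
  rw [cat]
  intros
  simp_all

theorem cat_append_eps {P : List (Instr w Reg Lab Op)} (h : NoEps P) (l l' : Option Lab)
    (B : Body w Reg Lab Op) (R : List (Instr w Reg Lab Op)) :
    cat (P ++ [⟨l, .eps⟩]) (⟨l', B⟩ :: R) = P ++ ⟨l.or l', B⟩ :: R := by
  induction P with
  | nil => rfl
  | cons I P ih =>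
    obtain ⟨hI, hP⟩ := noEps_cons.1 h
    rw [List.cons_append, cat_cons hI, ih hP, List.cons_append]

theorem cat_eq_append {P : List (Instr w Reg Lab Op)} (h : NoEps P)
    (R : List (Instr w Reg Lab Op)) : cat P R = P ++ R := by
  induction P with
  | nil => rfl
  | cons I P ih =>
    obtain ⟨hI, hP⟩ := noEps_cons.1 h
    rw [cat_cons hI, ih hP, List.cons_append]

theorem labelled_eq_relabel (l : Option Lab) (B : Body w Reg Lab Op)
    (T : List (Instr w Reg Lab Op)) : labelled l (⟨none, B⟩ :: T) = relabel l (⟨none, B⟩ :: T) := by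
  simp [labelled, cat, relabel]

theorem cat_labelled_nops (l : Option Lab) (k : ℕ) (B : Body w Reg Lab Op)
    (R : List (Instr w Reg Lab Op)) :
    cat (labelled l (nops k)) (⟨none, B⟩ :: R) = relabel l (nops k ++ [⟨none, B⟩]) ++ R := by
  cases k with
  | zero => simp [labelled, cat, relabel, nops]
  | succ k =>
    have h : labelled l (nops (k + 1) : List (Instr w Reg Lab Op)) = relabel l (nops (k + 1)) :=
      labelled_eq_relabel l _ _
    rw [h, cat_eq_append ((noEps_nops _).relabel l)]
    simp [nops, List.replicate_succ, relabel]

/-- The code of an expression of level `lev` with `n` steps is a straight line of `n` secure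
instructions, which for `lev = H` touch only high data; it is a lone empty instruction if
`n = 0`. -/
theorem ExprTyp.exists_block {Φ Φ' : RegRec Reg Var} {X : Set Reg} {l : Option Lab}
    {E : Expr w Var Op} {P : List (Instr w Reg Lab Op)} {lev : Level} {n : ℕ} {r : Reg}
    (h : ExprTyp A Φ X l E P lev n r Φ') :
    A.regLevel r = lev ∧ ∃ Bs : List (Body w Reg Lab Op), Bs.length = n ∧
      (∀ B ∈ Bs, A.SecureBody B) ∧ (lev = .H → ∀ B ∈ Bs, A.HighBody B) ∧
      (Bs = [] ∧ P = [⟨l, .eps⟩] ∨ Bs ≠ [] ∧ P = relabel l (block Bs)) := by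
  induction h with
  | @const Φ X l k r _ =>
    refine ⟨rfl, [.movek r k], rfl, by simp [Arch.SecureBody], ?_, .inr ⟨by simp, rfl⟩⟩
    simp [Arch.HighBody]
  | cached _ => exact ⟨rfl, [], rfl, by simp, by simp, .inl ⟨rfl, rfl⟩⟩
  | @uncached Φ X l x r _ hle =>
    refine ⟨rfl, [.load r (A.v2p x)], rfl, ?_, ?_, .inr ⟨by simp, rfl⟩⟩
    · simpa [Arch.SecureBody, A.cellLevel_v2p] using hle
    · simp [Arch.HighBody]
  | @op Φ Φ₁ Φ₂ X l o E₁ E₂ P₁ P₂ lev n₁ n₂ r r' _ _ ih₁ ih₂ =>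
    obtain ⟨hr, Bs₁, rfl, hs₁, hh₁, hP₁⟩ := ih₁
    obtain ⟨hr', Bs₂, rfl, hs₂, hh₂, hP₂⟩ := ih₂
    refine ⟨hr, Bs₁ ++ Bs₂ ++ [.op o r r'], by simp [Nat.add_assoc], ?_, ?_,
      .inr ⟨by simp, ?_⟩⟩
    · simp only [List.mem_append, List.mem_singleton]
      rintro B ((hB | hB) | rfl)
      · exact hs₁ B hB
      · exact hs₂ B hB
      · rw [Arch.SecureBody, hr, hr']
        cases lev <;> trivial
    · simp only [List.mem_append, List.mem_singleton]
      rintro hlev B ((hB | hB) | rfl)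
      · exact hh₁ hlev B hB
      · exact hh₂ hlev B hB
      · exact hr.trans hlev
    · have hn₁ := noEps_block_of_secure hs₁
      have hn₂ := noEps_block_of_secure hs₂
      rw [block_append, block_append]
      obtain ⟨rfl, rfl⟩ | ⟨hne₁, rfl⟩ := hP₁ <;> obtain ⟨rfl, rfl⟩ | ⟨hne₂, rfl⟩ := hP₂
      · simp [cat, instr, block, relabel]
      · obtain ⟨B, T, rfl⟩ := List.exists_cons_of_ne_nil hne₂
        have : cat [⟨l, .eps⟩] (relabel none (block (B :: T))) = relabel l (block (B :: T)) := by
          simp [cat, block, relabel]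
        rw [this, cat_eq_append (hn₂.relabel l)]
        rfl
      · obtain ⟨B, T, rfl⟩ := List.exists_cons_of_ne_nil hne₁
        rw [cat_eq_append (hn₁.relabel l), instr, cat_append_eps (hn₁.relabel l)]
        simp [block, relabel]
      · obtain ⟨B, T, rfl⟩ := List.exists_cons_of_ne_nil hne₁
        obtain ⟨B', T', rfl⟩ := List.exists_cons_of_ne_nil hne₂
        rw [cat_eq_append (hn₁.relabel l), cat_eq_append
          (noEps_append.2 ⟨hn₁.relabel l, hn₂.relabel none⟩)]
        rfl

/-- The code of an expression, followed by an unlabelled instruction and further code. -/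
theorem ExprTyp.exists_cat_eq {Φ Φ' : RegRec Reg Var} {X : Set Reg} {l : Option Lab}
    {E : Expr w Var Op} {P : List (Instr w Reg Lab Op)} {lev : Level} {n : ℕ} {r : Reg}
    (h : ExprTyp A Φ X l E P lev n r Φ') :
    A.regLevel r = lev ∧ ∃ Bs : List (Body w Reg Lab Op), Bs.length = n ∧
      (∀ B ∈ Bs, A.SecureBody B) ∧ (lev = .H → ∀ B ∈ Bs, A.HighBody B) ∧
      ∀ B R, cat P (⟨none, B⟩ :: R) = relabel l (block Bs ++ ⟨none, B⟩ :: R) := by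
  obtain ⟨hr, Bs, hn, hs, hh, hP⟩ := h.exists_block
  refine ⟨hr, Bs, hn, hs, hh, fun B R => ?_⟩
  obtain ⟨rfl, rfl⟩ | ⟨hne, rfl⟩ := hP
  · simp [cat, block, relabel]
  · rw [cat_eq_append ((noEps_block_of_secure hs).relabel l)]
    obtain ⟨B', T, rfl⟩ := List.exists_cons_of_ne_nil hne
    rfl

/-- The code of a conditional: `Bs` computes the guard into `r`, and `k₁`, `k₂` are the numbers of
padding instructions after the branches `P₁`, `P₂`. -/
def iteCode (l : Option Lab) (Bs : List (Body w Reg Lab Op)) (r : Reg) (br ex : Lab)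
    (P₁ : List (Instr w Reg Lab Op)) (l₁ : Option Lab) (k₁ : ℕ)
    (P₂ : List (Instr w Reg Lab Op)) (l₂ : Option Lab) (k₂ : ℕ) : List (Instr w Reg Lab Op) :=
  relabel l (block Bs ++ ⟨none, .jz br r⟩ ::
    (P₁ ++ (relabel l₁ (nops k₁ ++ [⟨none, .jmp ex⟩]) ++
      (relabel (some br) P₂ ++ relabel l₂ (nops k₂ ++ [⟨none, .nop⟩])))))

/-- The code of a loop with body `P`; the guard is refreshed from the memory cell `p` into `r`. -/
def loopCode (l : Option Lab) (r : Reg) (p : BitVec w) (lp ex : Lab)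
    (P : List (Instr w Reg Lab Op)) (l' : Option Lab) : List (Instr w Reg Lab Op) :=
  relabel l (block [.load r p, .store p r]) ++ ⟨some lp, .jz ex r⟩ ::
    (P ++ (relabel l' (block [.load r p, .store p r]) ++ block [.jmp lp]))

variable (A) in
/-- A security type system for structured machine code: `SecureCode A l P t e l' N` retains from
the compilation judgement what non-interference depends on.  Register records are forgotten,
expressions become straight lines of instructions, concatenation is plain, and the two rules for
conditionals are merged into one.  The three alternatives for the timing of a conditional are padded
branches of equal length in high code, arbitrary high code of timing `Trm H`, and a low guard. -/
inductive SecureCode : Option Lab → List (Instr w Reg Lab Op) → Timing → WriteEff → Option Lab →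
    Set Lab → Prop
  | straight {l : Option Lab} {Bs : List (Body w Reg Lab Op)} {t : Timing} {e : WriteEff} :
      Bs ≠ [] → (∀ B ∈ Bs, A.SecureBody B) → (e = .high → ∀ B ∈ Bs, A.HighBody B) →
      (∀ n, t = .exact n → n = Bs.length ∧ e = .high) →
      SecureCode l (relabel l (block Bs)) t e none ∅
  | ite {l l₁ l₂ : Option Lab} {Bs : List (Body w Reg Lab Op)} {r : Reg} {br ex : Lab}
      {P₁ P₂ : List (Instr w Reg Lab Op)} {t t₁ t₂ : Timing} {e e₁ e₂ : WriteEff} {k₁ k₂ : ℕ}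
      {N₁ N₂ : Set Lab} :
      (∀ B ∈ Bs, A.SecureBody B) →
      SecureCode none P₁ t₁ e₁ l₁ N₁ → SecureCode none P₂ t₂ e₂ l₂ N₂ →
      (e = .high → (∀ B ∈ Bs, A.HighBody B) ∧ e₁ = .high ∧ e₂ = .high) →
      ((∃ n₁ n₂, t₁ = .exact n₁ ∧ t₂ = .exact n₂ ∧ n₁ + k₁ = n₂ + k₂ ∧
          t = .exact (Bs.length + (n₁ + k₁) + 2) ∧ e = .high) ∨
        (t = .high ∧ e = .high) ∨
        (A.regLevel r = .L ∧ (∀ n, t ≠ .exact n) ∧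
          (t₁ = .high → t = .high) ∧ (t₂ = .high → t = .high))) →
      br ∉ N₁ ∪ N₂ → ex ∉ N₁ ∪ N₂ → br ≠ ex →
      SecureCode l (iteCode l Bs r br ex P₁ l₁ k₁ P₂ l₂ k₂) t e (some ex) (N₁ ∪ N₂ ∪ {br, ex})
  | seq {l l₁ l₂ : Option Lab} {P₁ P₂ : List (Instr w Reg Lab Op)} {t₁ t₂ : Timing}
      {e₁ e₂ : WriteEff} {N₁ N₂ : Set Lab} :
      SecureCode l P₁ t₁ e₁ l₁ N₁ → SecureCode l₁ P₂ t₂ e₂ l₂ N₂ →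
      (t₁ = .high → e₂ = .high) → Disjoint N₁ N₂ →
      SecureCode l (P₁ ++ P₂) (t₁.add t₂) (e₁.sup e₂) l₂ (N₁ ∪ N₂)
  | loop {l l' : Option Lab} {r : Reg} {p : BitVec w} {lp ex : Lab}
      {P : List (Instr w Reg Lab Op)} {t t' : Timing} {e e' : WriteEff} {N : Set Lab} :
      A.cellLevel p = A.regLevel r → SecureCode none P t e l' N →
      (e' = .high → A.regLevel r = .H ∧ e = .high) →
      (t' = .low ∧ A.regLevel r = .L ∧ t ≠ .high ∨ t' = .high ∧ e' = .high) →
      lp ∉ N → ex ∉ N → lp ≠ ex →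
      SecureCode l (loopCode l r p lp ex P l') t' e' (some ex) (N ∪ {lp, ex})

theorem SecureCode.exists_head {l l' : Option Lab} {P : List (Instr w Reg Lab Op)} {t : Timing}
    {e : WriteEff} {N : Set Lab} (h : SecureCode A l P t e l' N) : ∃ B T, P = ⟨l, B⟩ :: T := by
  induction h with
  | @straight l Bs t e hne _ _ _ =>
    obtain ⟨B, T, rfl⟩ := List.exists_cons_of_ne_nil hne
    exact ⟨B, _, rfl⟩
  | @ite l _ _ Bs =>
    cases Bs with
    | nil => exact ⟨_, _, rfl⟩
    | cons B Bs => exact ⟨_, _, rfl⟩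
  | seq _ _ _ _ ih₁ _ =>
    obtain ⟨B, T, rfl⟩ := ih₁
    exact ⟨B, _, rfl⟩
  | loop => exact ⟨_, _, rfl⟩

theorem SecureCode.noEps {l l' : Option Lab} {P : List (Instr w Reg Lab Op)} {t : Timing}
    {e : WriteEff} {N : Set Lab} (h : SecureCode A l P t e l' N) : NoEps P := by
  induction h with
  | straight _ hs _ _ => exact (noEps_block_of_secure hs).relabel _
  | ite hs _ _ _ _ _ _ _ ih₁ ih₂ =>
    refine NoEps.relabel (noEps_append.2 ⟨noEps_block_of_secure hs, noEps_cons.2 ⟨by simp,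
      noEps_append.2 ⟨ih₁, noEps_append.2 ⟨NoEps.relabel ?_ _,
      noEps_append.2 ⟨ih₂.relabel _, NoEps.relabel ?_ _⟩⟩⟩⟩⟩) _ <;>
    exact noEps_append.2 ⟨noEps_nops _, by simp [NoEps]⟩
  | seq _ _ _ _ ih₁ ih₂ => exact noEps_append.2 ⟨ih₁, ih₂⟩
  | loop _ _ _ _ _ _ _ ih =>
    have h2 : ∀ (r : Reg) (p : BitVec w),
        NoEps (block [Body.load r p, Body.store p r] : List (Instr w Reg Lab Op)) := by
      simp [NoEps, block]
    exact noEps_append.2 ⟨(h2 _ _).relabel _, noEps_cons.2 ⟨by simp, noEps_append.2 ⟨ih,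
      noEps_append.2 ⟨(h2 _ _).relabel _, by simp [NoEps, block]⟩⟩⟩⟩

end Shape

/-! ### Typed compilation produces secure code -/

section Typing

variable {w : ℕ} {Var Reg Lab Op CodeLoc : Type*} {A : Arch w Var Reg Lab Op CodeLoc}

theorem Timing.join_eq_high_iff {t₁ t₂ : Timing} :
    t₁.join t₂ = .high ↔ t₁ = .high ∨ t₂ = .high := by
  cases t₁ <;> cases t₂ <;> simp [Timing.join, Timing.le]

theorem Timing.join_ne_exact (t₁ t₂ : Timing) (n : ℕ) : t₁.join t₂ ≠ .exact n := by
  cases t₁ <;> cases t₂ <;> simp [Timing.join, Timing.le]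

theorem Timing.add_eq_high_iff {t₁ t₂ : Timing} :
    t₁.add t₂ = .high ↔ t₁ = .high ∨ t₂ = .high := by
  cases t₁ <;> cases t₂ <;> simp [Timing.add, Timing.join, Timing.le]

theorem Timing.add_eq_exact_iff {t₁ t₂ : Timing} {n : ℕ} :
    t₁.add t₂ = .exact n ↔ ∃ n₁ n₂, t₁ = .exact n₁ ∧ t₂ = .exact n₂ ∧ n₁ + n₂ = n := by
  cases t₁ <;> cases t₂ <;> simp [Timing.add, Timing.join, Timing.le]

theorem WriteEff.sup_eq_high_iff {e₁ e₂ : WriteEff} :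
    e₁.sup e₂ = .high ↔ e₁ = .high ∧ e₂ = .high := by
  cases e₁ <;> cases e₂ <;> simp [WriteEff.sup]

theorem WriteEff.le.eq_high {e e' : WriteEff} (h : e.le e') (h' : e' = .high) : e = .high := by
  cases e <;> simp_all [WriteEff.le]

theorem Level.write_eq_high_iff {lev : Level} : lev.write = .high ↔ lev = .H := by
  cases lev <;> simp [Level.write]

theorem atomTiming_eq_exact_iff {lev : Level} {m n : ℕ} :
    atomTiming lev m = .exact n ↔ lev = .H ∧ n = m + 1 := by
  cases lev <;> simp [atomTiming, eq_comm]

/-- An expression followed by a single instruction that uses its value. -/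
theorem ExprTyp.secureCode {Φ Φ' : RegRec Reg Var} {l : Option Lab} {E : Expr w Var Op}
    {P : List (Instr w Reg Lab Op)} {lev : Level} {n : ℕ} {r : Reg}
    (h : ExprTyp A Φ ∅ l E P lev n r Φ') {B : Body w Reg Lab Op}
    (hB : A.regLevel r = lev → A.SecureBody B) (hB' : lev = .H → A.HighBody B) :
    SecureCode A l (cat P (instr B)) (atomTiming lev n) lev.write none ∅ := by
  obtain ⟨hr, Bs, rfl, hs, hh, hcat⟩ := h.exists_cat_eq
  have hcode : cat P (instr B) = relabel l (block (Bs ++ [B])) := by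
    rw [instr, hcat, block_append]
    rfl
  rw [hcode]
  refine .straight (by simp) ?_ ?_ ?_
  · rintro B' hB₁
    obtain hB₁ | hB₁ := List.mem_append.1 hB₁
    · exact hs B' hB₁
    · rw [List.mem_singleton.1 hB₁]
      exact hB hr
  · rintro hlev B' hB₁
    rw [Level.write_eq_high_iff] at hlev
    obtain hB₁ | hB₁ := List.mem_append.1 hB₁
    · exact hh hlev B' hB₁
    · rw [List.mem_singleton.1 hB₁]
      exact hB' hlev
  · intro n hn
    rw [atomTiming_eq_exact_iff] at hn
    exact ⟨by simpa using hn.2, Level.write_eq_high_iff.2 hn.1⟩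

/-- The concatenations in the rule for conditionals with padding. -/
theorem cat_ite_eq_iteCode {l l₁ l₂ : Option Lab} {P₀ P₁ P₂ : List (Instr w Reg Lab Op)}
    {Bs : List (Body w Reg Lab Op)} {r : Reg} {br ex : Lab}
    (hP₀ : ∀ B R, cat P₀ (⟨none, B⟩ :: R) = relabel l (block Bs ++ ⟨none, B⟩ :: R))
    (h₁ : NoEps P₁) (h₂ : NoEps P₂) (hd₂ : ∃ B T, P₂ = ⟨none, B⟩ :: T) (k₁ k₂ : ℕ) :
    cat P₀ (cat (instr (.jz br r)) (cat P₁ (cat (labelled l₁ (nops k₁)) (cat (instr (.jmp ex))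
      (cat (labelled (some br) P₂) (cat (labelled l₂ (nops k₂)) (instr .nop))))))) =
      iteCode l Bs r br ex P₁ l₁ k₁ P₂ l₂ k₂ := by
  obtain ⟨B, T, rfl⟩ := hd₂
  have hI : ∀ {B : Body w Reg Lab Op} {R}, B ≠ .eps → cat (instr B) R = ⟨none, B⟩ :: R :=
    fun {B R} hB => cat_eq_append (P := [⟨none, B⟩]) (by simpa [NoEps] using hB) R
  rw [hI (B := .jz br r) nofun, hP₀, hI (B := .jmp ex) nofun, cat_eq_append h₁,
    cat_labelled_nops, labelled_eq_relabel, cat_eq_append (h₂.relabel _), iteCode, instr,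
    cat_labelled_nops, List.append_nil]

/-- The concatenations in the rule for conditionals without padding. -/
theorem cat_ite_eq_iteCode_zero {l l₁ l₂ : Option Lab} {P₀ P₁ P₂ : List (Instr w Reg Lab Op)}
    {Bs : List (Body w Reg Lab Op)} {r : Reg} {br ex : Lab}
    (hP₀ : ∀ B R, cat P₀ (⟨none, B⟩ :: R) = relabel l (block Bs ++ ⟨none, B⟩ :: R))
    (h₁ : NoEps P₁) (h₂ : NoEps P₂) (hd₂ : ∃ B T, P₂ = ⟨none, B⟩ :: T) :
    cat P₀ (cat (instr (.jz br r)) (cat P₁ (cat [⟨l₁, .jmp ex⟩]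
      (cat (labelled (some br) P₂) [⟨l₂, .nop⟩])))) =
      iteCode l Bs r br ex P₁ l₁ 0 P₂ l₂ 0 := by
  rw [← cat_ite_eq_iteCode hP₀ h₁ h₂ hd₂]
  have h0 : ∀ (l : Option Lab) (B : Body w Reg Lab Op) R,
      cat (labelled l (nops 0)) (⟨none, B⟩ :: R) = ⟨l, B⟩ :: R := fun l B R => by
    rw [cat_labelled_nops]
    rfl
  rw [cat_eq_append (P := [⟨l₁, .jmp ex⟩]) (by simp [NoEps]),
    cat_eq_append (P := instr (.jmp ex)) (by simp [NoEps, instr]), instr, instr, instr,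
    h0 l₂, List.singleton_append, List.singleton_append, h0 l₁]

theorem CmdTyp.secureCode {Φ Φ' : RegRec Reg Var} {l l' : Option Lab} {C : Cmd w Var Op}
    {P : List (Instr w Reg Lab Op)} {t : Timing} {e : WriteEff} {N : Set Lab}
    (h : CmdTyp A Φ l C P t e l' Φ' N) : SecureCode A l P t e l' N := by
  induction h with
  | @skip Φ l =>
    exact .straight (Bs := [.nop]) (by simp) (by simp [Arch.SecureBody])
      (by simp [Arch.HighBody]) (by simp [eq_comm])
  | @assign Φ Φ' l x E P n r hE =>
    refine hE.secureCode (fun hr => ?_) fun hx => (A.cellLevel_v2p x).trans hx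
    rw [Arch.SecureBody, hr, A.cellLevel_v2p]
    cases A.varLevel x <;> trivial
  | @out Φ Φ' l ch E P n r hE =>
    refine hE.secureCode (fun hr => ?_) fun hx => ?_
    · rw [Arch.SecureBody, hr]
      cases ch <;> trivial
    · cases ch with
      | low => cases hx
      | high => rfl
  | @ifAny Φ Φ₁ Φ₂ Φ₃ l l₁ l₂ E C₁ C₂ P₀ P₁ P₂ lev n₀ r t₁ t₂ e₁ e₂ br ex N₁ N₂
      hE _ _ he₁ he₂ _ hbr hex hne ih₁ ih₂ =>
    obtain ⟨hr, Bs, rfl, hs, hh, hcat⟩ := hE.exists_cat_eq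
    rw [cat_ite_eq_iteCode_zero hcat ih₁.noEps ih₂.noEps ih₂.exists_head]
    refine .ite hs ih₁ ih₂ (fun hlev => ?_) (.inr ?_) hbr hex hne
    · exact ⟨hh (Level.write_eq_high_iff.1 hlev), he₁.eq_high hlev, he₂.eq_high hlev⟩
    · cases lev with
      | H => exact .inl ⟨by simp [Timing.join_eq_high_iff, Level.term], rfl⟩
      | L =>
        exact .inr ⟨hr, Timing.join_ne_exact _ _, by simp +contextual [Timing.join_eq_high_iff],
          by simp +contextual [Timing.join_eq_high_iff]⟩
  | @ifHigh Φ Φ₁ Φ₂ Φ₃ l l₁ l₂ E C₁ C₂ P₀ P₁ P₂ n₀ n₁ n₂ r br ex N₁ N₂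
      hE _ _ _ hbr hex hne ih₁ ih₂ =>
    obtain ⟨hr, Bs, rfl, hs, hh, hcat⟩ := hE.exists_cat_eq
    rw [cat_ite_eq_iteCode hcat ih₁.noEps ih₂.noEps ih₂.exists_head]
    refine .ite hs ih₁ ih₂ (fun _ => ⟨hh rfl, rfl, rfl⟩) (.inl ⟨n₁, n₂, rfl, rfl, ?_, ?_, rfl⟩)
      hbr hex hne
    · omega
    · congr 2
      omega
  | seq _ _ ht hN ih₁ ih₂ =>
    rw [cat_eq_append ih₁.noEps]
    exact .seq ih₁ ih₂ ht hN
  | _ =>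
    -- the only case left is that of a loop
    rename_i l l' x r C P lev t e lp ex N hx hr ht he _ _ _ hlp hex hne ih
    have hcode : cat [⟨l, .load r (A.v2p x)⟩, ⟨none, .store (A.v2p x) r⟩]
          (cat [⟨some lp, .jz ex r⟩] (cat P
          (cat [⟨l', .load r (A.v2p x)⟩, ⟨none, .store (A.v2p x) r⟩] (instr (.jmp lp))))) =
        loopCode l r (A.v2p x) lp ex P l' := by
      rw [cat_eq_append (by simp [NoEps]), cat_eq_append (by simp [NoEps]),
        cat_eq_append ih.noEps, cat_eq_append (by simp [NoEps])]
      rfl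
    rw [hcode]
    refine .loop (by rw [A.cellLevel_v2p, ← hx, hr]) ih
      (fun hlev => ⟨hr ▸ Level.write_eq_high_iff.1 hlev, he.eq_high hlev⟩) ?_ hlp hex hne
    cases lev with
    | H => exact .inr ⟨by simp [Timing.join_eq_high_iff, Level.term], rfl⟩
    | L =>
      have : t ≠ .high := fun h => by simpa [Level.write] using ht h
      refine .inl ⟨?_, hr.symm, this⟩
      cases t <;> simp_all [Timing.join, Timing.le, Level.term]

/-- Every label in `P` belongs to `M`. -/
def LabelsIn (M : Set Lab) (P : List (Instr w Reg Lab Op)) : Prop :=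
  ∀ I ∈ P, ∀ x, I.lab = some x → x ∈ M

theorem labelsIn_append {M : Set Lab} {P P' : List (Instr w Reg Lab Op)} :
    LabelsIn M (P ++ P') ↔ LabelsIn M P ∧ LabelsIn M P' := List.forall_mem_append

theorem labelsIn_cons {M : Set Lab} {I : Instr w Reg Lab Op} {P : List (Instr w Reg Lab Op)} :
    LabelsIn M (I :: P) ↔ (∀ x, I.lab = some x → x ∈ M) ∧ LabelsIn M P := List.forall_mem_cons

theorem LabelsIn.mono {M M' : Set Lab} (hM : M ⊆ M') {P : List (Instr w Reg Lab Op)}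
    (h : LabelsIn M P) : LabelsIn M' P := fun I hI x hx => hM (h I hI x hx)

theorem labelsIn_block (M : Set Lab) (Bs : List (Body w Reg Lab Op)) :
    LabelsIn M (block Bs) := by
  simp [LabelsIn, block]

theorem LabelsIn.tail {M : Set Lab} {P : List (Instr w Reg Lab Op)} (h : LabelsIn M P) :
    LabelsIn M P.tail := fun I hI => h I (List.mem_of_mem_tail hI)

theorem labelsIn_relabel {M : Set Lab} {l : Option Lab} {P : List (Instr w Reg Lab Op)}
    (hl : ∀ x, l = some x → x ∈ M) (h : LabelsIn M P.tail) : LabelsIn M (relabel l P) := by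
  cases P with
  | nil => exact h
  | cons I P => exact labelsIn_cons.2 ⟨hl, h⟩

theorem tail_relabel (l : Option Lab) (P : List (Instr w Reg Lab Op)) :
    (relabel l P).tail = P.tail := by
  cases P <;> rfl

/-- Apart from the label of the first instruction, the labels of secure code are among the
generated ones and differ from the exit label, which is itself a generated one. -/
theorem SecureCode.labels {l l' : Option Lab} {P : List (Instr w Reg Lab Op)} {t : Timing}
    {e : WriteEff} {N : Set Lab} (h : SecureCode A l P t e l' N) :
    LabelsIn (N \ {x | l' = some x}) P.tail ∧ ∀ x, l' = some x → x ∈ N := by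
  induction h with
  | @straight l Bs =>
    rw [tail_relabel]
    exact ⟨(labelsIn_block _ Bs).tail, nofun⟩
  | @ite l l₁ l₂ Bs r br ex P₁ P₂ t t₁ t₂ e e₁ e₂ k₁ k₂ N₁ N₂ _ h₁ h₂ _ _ hbr hex hne ih₁ ih₂ =>
    refine ⟨?_, by simp⟩
    obtain ⟨B₁, T₁, rfl⟩ := h₁.exists_head
    rw [iteCode, tail_relabel]
    have hM : ∀ x, x ∈ N₁ ∪ N₂ → x ∈ (N₁ ∪ N₂ ∪ {br, ex}) \ {x | some ex = some x} :=
      fun x hx => ⟨.inl hx, fun h => hex (by cases h; exact hx)⟩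
    have hblock : ∀ {M : Set Lab} (k : ℕ) (B : Body w Reg Lab Op),
        LabelsIn M (nops k ++ [⟨none, B⟩]) := fun k B => by
      rw [nops_eq_block]
      exact labelsIn_append.2 ⟨labelsIn_block _ _, labelsIn_block _ [B]⟩
    refine (labelsIn_append.2 ⟨labelsIn_block _ _, labelsIn_cons.2 ⟨nofun,
      labelsIn_append.2 ⟨labelsIn_cons.2 ⟨nofun, ih₁.1.mono ?_⟩, labelsIn_append.2 ⟨?_,
      labelsIn_append.2 ⟨?_, ?_⟩⟩⟩⟩⟩).tail
    · exact fun x hx => hM x (.inl hx.1)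
    · exact labelsIn_relabel (fun x hx => hM x (.inl (ih₁.2 x hx))) (hblock _ _).tail
    · refine labelsIn_relabel (fun x hx => ?_) (ih₂.1.mono fun x hx => hM x (.inr hx.1))
      cases hx
      exact ⟨by simp, fun h => hne (by cases h; rfl)⟩
    · exact labelsIn_relabel (fun x hx => hM x (.inr (ih₂.2 x hx))) (hblock _ _).tail
  | @seq l l₁ l₂ P₁ P₂ t₁ t₂ e₁ e₂ N₁ N₂ h₁ h₂ _ hN ih₁ ih₂ =>
    refine ⟨?_, fun x hx => .inr (ih₂.2 x hx)⟩
    obtain ⟨B₁, T₁, rfl⟩ := h₁.exists_head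
    obtain ⟨B₂, T₂, rfl⟩ := h₂.exists_head
    have hM : ∀ x ∈ N₁, x ∈ (N₁ ∪ N₂) \ {x | l₂ = some x} :=
      fun x hx => ⟨.inl hx, fun h => Set.disjoint_left.1 hN hx (ih₂.2 x h)⟩
    refine labelsIn_append.2 ⟨ih₁.1.mono fun x hx => hM x hx.1, labelsIn_cons.2
      ⟨fun x hx => hM x (ih₁.2 x hx), LabelsIn.mono (fun x hx => ?_) ih₂.1⟩⟩
    exact ⟨.inr hx.1, hx.2⟩
  | @loop l l' r p lp ex P t t' e e' N _ hP _ _ hlp hex hne ih =>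
    refine ⟨?_, by simp⟩
    obtain ⟨B, T, rfl⟩ := hP.exists_head
    have hM : ∀ x ∈ N, x ∈ (N ∪ {lp, ex}) \ {x | some ex = some x} :=
      fun x hx => ⟨.inl hx, fun h => hex (by cases h; exact hx)⟩
    change LabelsIn _ (block [.store p r] ++ ⟨some lp, .jz ex r⟩ :: (⟨none, B⟩ :: T ++
      (relabel l' (block [.load r p, .store p r]) ++ block [.jmp lp])))
    refine labelsIn_append.2 ⟨labelsIn_block _ _, labelsIn_cons.2 ⟨fun x hx => ?_,
      labelsIn_append.2 ⟨labelsIn_cons.2 ⟨nofun, ih.1.mono fun x hx => hM x hx.1⟩,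
      labelsIn_append.2 ⟨labelsIn_relabel (fun x hx => hM x (ih.2 x hx))
        (labelsIn_block _ [.store p r]), labelsIn_block _ _⟩⟩⟩⟩
    cases hx
    exact ⟨by simp, fun h => hne (by cases h; rfl)⟩

end Typing

open Arch

/-! ### Placement of code -/

section Placement

variable {w : ℕ} {Var Reg Lab Op CodeLoc : Type*} {A : Arch w Var Reg Lab Op CodeLoc}
  {Q : Code w Reg Lab Op}

/-- The code `P` is found in `Q` from position `i` on; instructions without a label in `P` may
have one in `Q`. -/
def Placed (Q : Code w Reg Lab Op) : ℕ → List (Instr w Reg Lab Op) → Prop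
  | _, [] => True
  | i, I :: P => (HasBody Q i I.body ∧ ∀ x, I.lab = some x → HasLab Q x i) ∧ Placed Q (i + 1) P

/-- The label `l`, unless empty, is attached to position `j` of `Q`. -/
def Resolved (Q : Code w Reg Lab Op) (l : Option Lab) (j : ℕ) : Prop :=
  ∀ x, l = some x → HasLab Q x j

/-- Position `j` is where control goes with the exit label `l`: the label is attached to `j`, or
`j` is the end of `Q` and the label does not occur, so that jumps to it are stuck. -/
def Exit (Q : Code w Reg Lab Op) (l : Option Lab) (j : ℕ) : Prop :=
  ∀ x, l = some x → Target Q x j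

theorem Resolved.exit {l : Option Lab} {j : ℕ} (h : Resolved Q l j) : Exit Q l j :=
  fun x hx => .inl (h x hx)

theorem placed_append {i : ℕ} {P P' : List (Instr w Reg Lab Op)} :
    Placed Q i (P ++ P') ↔ Placed Q i P ∧ Placed Q (i + P.length) P' := by
  induction P generalizing i with
  | nil => simp [Placed]
  | cons I P ih =>
    rw [List.cons_append, Placed, Placed, ih, List.length_cons, Nat.add_right_comm,
      Nat.add_assoc i]
    exact and_assoc.symm

theorem placed_relabel {i : ℕ} {l : Option Lab} {P : List (Instr w Reg Lab Op)}
    (hP : ∃ B T, P = ⟨none, B⟩ :: T) (h : Placed Q i (relabel l P)) :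
    Resolved Q l i ∧ Placed Q i P := by
  obtain ⟨B, T, rfl⟩ := hP
  exact ⟨h.1.2, ⟨h.1.1, nofun⟩, h.2⟩

theorem placed_self (Q : Code w Reg Lab Op) : Placed Q 0 Q.1 := by
  suffices ∀ P P₀ : List (Instr w Reg Lab Op), Q.1 = P₀ ++ P → Placed Q P₀.length P from
    this Q.1 [] rfl
  intro P
  induction P with
  | nil => exact fun _ _ => trivial
  | cons I P ih =>
    intro P₀ h
    have hI : Q.1[P₀.length]? = some I := by simp [h]
    refine ⟨⟨⟨I, hI, rfl⟩, fun x hx => ⟨I, hI, hx⟩⟩, ?_⟩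
    have := ih (P₀ ++ [I]) (by simp [h])
    rwa [List.length_append] at this

theorem SecureCode.resolved {l l' : Option Lab} {P : List (Instr w Reg Lab Op)} {t : Timing}
    {e : WriteEff} {N : Set Lab} (h : SecureCode A l P t e l' N) {i : ℕ} (hP : Placed Q i P) :
    Resolved Q l i := by
  obtain ⟨B, T, rfl⟩ := h.exists_head
  exact hP.1.2

theorem exists_head_block_append (Bs : List (Body w Reg Lab Op)) (B : Body w Reg Lab Op)
    (R : List (Instr w Reg Lab Op)) : ∃ B' T, block Bs ++ ⟨none, B⟩ :: R = ⟨none, B'⟩ :: T := by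
  cases Bs with
  | nil => exact ⟨_, _, rfl⟩
  | cons B' Bs => exact ⟨_, _, rfl⟩

/-- The pieces of a conditional and their positions: `i₁` is that of the conditional jump, `i₂`
that of the exit of the first branch, `i₃` that of the second branch and `i₄` that of its exit. -/
theorem placed_iteCode {l l₁ l₂ : Option Lab} {Bs : List (Body w Reg Lab Op)} {r : Reg}
    {br ex : Lab} {P₁ P₂ : List (Instr w Reg Lab Op)} {k₁ k₂ i j : ℕ}
    (hP₂ : ∃ B T, P₂ = ⟨none, B⟩ :: T)
    (h : Placed Q i (iteCode l Bs r br ex P₁ l₁ k₁ P₂ l₂ k₂))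
    (hj : j = i + (iteCode l Bs r br ex P₁ l₁ k₁ P₂ l₂ k₂).length) :
    ∃ i₁ i₂ i₃ i₄, i₁ = i + Bs.length ∧ i₂ = i₁ + 1 + P₁.length ∧ i₃ = i₂ + k₁ + 1 ∧
      i₄ = i₃ + P₂.length ∧ j = i₄ + k₂ + 1 ∧ Placed Q i (block Bs) ∧
      HasBody Q i₁ (.jz br r) ∧ Placed Q (i₁ + 1) P₁ ∧ Resolved Q l₁ i₂ ∧
      Placed Q i₂ (block (List.replicate k₁ .nop)) ∧ HasBody Q (i₂ + k₁) (.jmp ex) ∧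
      HasLab Q br i₃ ∧ Placed Q i₃ P₂ ∧ Resolved Q l₂ i₄ ∧
      Placed Q i₄ (block (List.replicate k₂ .nop)) ∧ HasBody Q (i₄ + k₂) .nop := by
  have hlen : ∀ (l : Option Lab) (P : List (Instr w Reg Lab Op)),
      (relabel l P).length = P.length := by
    rintro l (_ | ⟨_, _⟩) <;> rfl
  simp only [iteCode, hlen, nops_eq_block, List.length_append, List.length_cons, length_block,
    List.length_replicate, List.length_nil] at h hj
  obtain ⟨-, h⟩ := placed_relabel (exists_head_block_append _ _ _) h
  rw [placed_append, Placed, placed_append, placed_append, placed_append] at h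
  simp only [hlen, length_block, List.length_append, List.length_replicate, List.length_cons,
    List.length_nil] at h
  obtain ⟨hBs, ⟨⟨hjz, -⟩, hP₁, hk₁, hP₂', hk₂⟩⟩ := h
  obtain ⟨hl₁, hk₁⟩ := placed_relabel (exists_head_block_append _ _ _) hk₁
  obtain ⟨hbr, hP₂'⟩ := placed_relabel hP₂ hP₂'
  obtain ⟨hl₂, hk₂⟩ := placed_relabel (exists_head_block_append _ _ _) hk₂
  rw [placed_append, length_block, List.length_replicate] at hk₁ hk₂
  exact ⟨_, _, _, _, rfl, rfl, rfl, rfl, by omega, hBs, hjz, hP₁, hl₁, hk₁.1, hk₁.2.1.1,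
    hbr br rfl, hP₂', hl₂, hk₂.1, hk₂.2.1.1⟩

/-- The pieces of a loop and their positions: `i + 2` is that of the conditional jump and `k` that
of the exit of the body. -/
theorem placed_loopCode {l l' : Option Lab} {r : Reg} {p : BitVec w} {lp ex : Lab}
    {P : List (Instr w Reg Lab Op)} {i j : ℕ} (h : Placed Q i (loopCode l r p lp ex P l'))
    (hj : j = i + (loopCode l r p lp ex P l').length) :
    ∃ k, k = i + 3 + P.length ∧ j = k + 3 ∧ Placed Q i (block [.load r p, .store p r]) ∧
      HasBody Q (i + 2) (.jz ex r) ∧ HasLab Q lp (i + 2) ∧ Placed Q (i + 3) P ∧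
      Resolved Q l' k ∧ Placed Q k (block [.load r p, .store p r]) ∧
      HasBody Q (k + 2) (.jmp lp) := by
  rw [loopCode, placed_append, Placed, placed_append, placed_append] at h
  obtain ⟨h₁, ⟨hjz, hlp⟩, hP, h₂, h₃⟩ := h
  obtain ⟨-, h₁⟩ := placed_relabel ⟨_, _, rfl⟩ h₁
  obtain ⟨hl', h₂⟩ := placed_relabel ⟨_, _, rfl⟩ h₂
  refine ⟨_, rfl, ?_, h₁, hjz, hlp lp rfl, hP, hl', h₂, h₃.1.1⟩
  rw [hj, loopCode]
  simp [relabel, block]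
  omega

end Placement

/-! ### Secure code is non-interferent under faults -/

section Security

variable {w : ℕ} {Var Reg Lab Op CodeLoc : Type*} [DecidableEq Reg]
  {A : Arch w Var Reg Lab Op CodeLoc} {Q : Code w Reg Lab Op}

theorem reachAt_block {i j : ℕ} {Bs : List (Body w Reg Lab Op)} (h : ∀ B ∈ Bs, A.HighBody B)
    (hP : Placed Q i (block Bs)) (hj : j = i + Bs.length) : A.ReachAt Q Bs.length i j := by
  subst hj
  induction Bs generalizing i with
  | nil => exact fun s hs => hs
  | cons B Bs ih =>
    obtain ⟨hB, hBs⟩ := List.forall_mem_cons.1 h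
    have := (hB.reachAt hP.1.1).trans (ih hBs hP.2)
    rwa [Nat.add_assoc, Nat.add_comm 1] at this

theorem secureAt_block {n i j : ℕ} {Bs : List (Body w Reg Lab Op)}
    (h : ∀ B ∈ Bs, A.SecureBody B) (hP : Placed Q i (block Bs)) (hj : j = i + Bs.length)
    (hn : A.SecureAt Q n j) : A.SecureAt Q n i := by
  subst hj
  induction Bs generalizing i with
  | nil => exact hn
  | cons B Bs ih =>
    obtain ⟨hB, hBs⟩ := List.forall_mem_cons.1 h
    refine hB.secureAt hP.1.1 (ih hBs hP.2 ?_)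
    rwa [Nat.add_assoc, Nat.add_comm 1]

theorem reachAt_nops {i k : ℕ} (hP : Placed Q i (block (List.replicate k .nop))) :
    A.ReachAt Q k i (i + k) := by
  have := reachAt_block (A := A) (j := i + k)
    (fun B hB => by rw [List.eq_of_mem_replicate hB]; trivial) hP (by simp)
  rwa [List.length_replicate] at this

theorem reachAt_nop {i : ℕ} (h : HasBody Q i .nop) : A.ReachAt Q 1 i (i + 1) :=
  HighBody.reachAt (B := .nop) trivial h

/-- Code with the write effect `wr H` is silent as long as what follows it is. -/
theorem SecureCode.quietAt {l l' : Option Lab} {P : List (Instr w Reg Lab Op)} {t : Timing}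
    {e : WriteEff} {N : Set Lab} (h : SecureCode A l P t e l' N) (he : e = .high) {i j : ℕ}
    (hP : Placed Q i P) (hj : j = i + P.length) (hl : Exit Q l' j) {n : ℕ}
    (hn : A.QuietAt Q n j) : A.QuietAt Q n i := by
  induction h generalizing i j n with
  | @straight l Bs t e hne _ hh _ =>
    obtain ⟨B, T, rfl⟩ := List.exists_cons_of_ne_nil hne
    exact (reachAt_block (hh he) (placed_relabel ⟨_, _, rfl⟩ hP).2
      (hj.trans (by simp [relabel, block]))).quietAt hn
  | ite _ h₁ h₂ hh _ _ _ _ ih₁ ih₂ =>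
    obtain ⟨hBs, he₁, he₂⟩ := hh he
    obtain ⟨i₁, i₂, i₃, i₄, hi₁, hi₂, hi₃, hi₄, rfl, pBs, pjz, p₁, pl₁, pk₁, pjmp, pbr, p₂, pl₂,
      pk₂, pnop⟩ := placed_iteCode h₂.exists_head hP hj
    have q₃ := ih₂ he₂ p₂ hi₄ pl₂.exit
      ((reachAt_nops pk₂).quietAt ((reachAt_nop pnop).quietAt hn))
    have q₁ := ih₁ he₁ p₁ hi₂ pl₁.exit
      ((reachAt_nops pk₁).quietAt (quietAt_jmp pjmp (hl _ rfl) hn))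
    exact (reachAt_block hBs pBs hi₁).quietAt
      ((quietAt_jz pjz (.inl pbr) q₃ q₁).mono (Nat.le_succ n))
  | seq h₁ h₂ _ _ ih₁ ih₂ =>
    obtain ⟨he₁, he₂⟩ := WriteEff.sup_eq_high_iff.1 he
    obtain ⟨p₁, p₂⟩ := placed_append.1 hP
    exact ih₁ he₁ p₁ rfl (h₂.resolved p₂).exit
      (ih₂ he₂ p₂ (by rw [hj, List.length_append, Nat.add_assoc]) hl hn)
  | @loop l l' r p lp ex P t t' e e' N hp _ hh _ _ _ _ ih =>
    obtain ⟨hr, he'⟩ := hh he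
    obtain ⟨k, hk, rfl, p₁, pjz, plp, pP, pl', p₂, pjmp⟩ := placed_loopCode hP hj
    have hB : ∀ B ∈ [Body.load r p, Body.store p r], A.HighBody B := by
      simp [HighBody, hp, hr]
    -- every round of the loop takes at least one transition, that of the conditional jump
    have key : ∀ m ≤ n, A.QuietAt Q m (i + 2) := by
      intro m
      induction m with
      | zero => exact fun _ _ _ => trivial
      | succ m ihm =>
        intro hm
        exact quietAt_jz pjz (hl _ rfl) (hn.mono (by omega)) (ih he' pP hk pl'.exit
          ((reachAt_block hB p₂ rfl).quietAt ((reachAt_jmp pjmp plp).quietAt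
            (ihm (by omega)))))
    exact (reachAt_block hB p₁ rfl).quietAt (key n le_rfl)

/-- Code with the timing `Trm m` silently reaches its exit in exactly `m` transitions, whatever
branches it takes. -/
theorem SecureCode.reachAt {l l' : Option Lab} {P : List (Instr w Reg Lab Op)} {t : Timing}
    {e : WriteEff} {N : Set Lab} (h : SecureCode A l P t e l' N) {m : ℕ} (ht : t = .exact m)
    {i j : ℕ} (hP : Placed Q i P) (hj : j = i + P.length) (hl : Resolved Q l' j) :
    A.ReachAt Q m i j := by
  induction h generalizing i j m with
  | @straight l Bs t e hne _ hh hn =>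
    obtain ⟨B, T, rfl⟩ := List.exists_cons_of_ne_nil hne
    obtain ⟨rfl, he⟩ := hn m ht
    exact reachAt_block (hh he) (placed_relabel ⟨_, _, rfl⟩ hP).2
      (hj.trans (by simp [relabel, block]))
  | ite _ h₁ h₂ hh hcase _ _ _ ih₁ ih₂ =>
    obtain ⟨n₁, n₂, ht₁, ht₂, hk, ht', he⟩ | ⟨ht', -⟩ | ⟨-, ht', -⟩ := hcase
    · obtain ⟨hBs, -⟩ := hh he
      obtain ⟨i₁, i₂, i₃, i₄, hi₁, hi₂, rfl, hi₄, rfl, pBs, pjz, p₁, pl₁, pk₁, pjmp, pbr, p₂,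
        pl₂, pk₂, pnop⟩ := placed_iteCode h₂.exists_head hP hj
      have q₃ := (ih₂ ht₂ p₂ hi₄ pl₂).trans ((reachAt_nops pk₂).trans (reachAt_nop pnop))
      have q₁ := (ih₁ ht₁ p₁ hi₂ pl₁).trans
        ((reachAt_nops pk₁).trans (reachAt_jmp pjmp (hl _ rfl)))
      rw [← Nat.add_assoc, ← hk, Nat.add_assoc] at q₃
      have := (reachAt_block hBs pBs hi₁).trans (reachAt_jz pjz pbr q₃ q₁)
      rw [ht, Timing.exact.injEq] at ht'
      rw [ht']
      convert this using 1
      omega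
    · simp [ht] at ht'
    · exact absurd ht (ht' m)
  | seq h₁ h₂ _ _ ih₁ ih₂ =>
    obtain ⟨n₁, n₂, ht₁, ht₂, rfl⟩ := Timing.add_eq_exact_iff.1 ht
    obtain ⟨p₁, p₂⟩ := placed_append.1 hP
    exact (ih₁ ht₁ p₁ rfl (h₂.resolved p₂)).trans
      (ih₂ ht₂ p₂ (by rw [hj, List.length_append, Nat.add_assoc]) hl)
  | loop _ _ _ ht' =>
    obtain ⟨ht', -⟩ | ⟨ht', -⟩ := ht' <;> simp [ht] at ht'

/-- Secure code is secure for as many transitions as the position after it is; if its timing is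
`Trm H`, that position must even be quiet, since it may be reached at different times. -/
theorem SecureCode.secureAt {l l' : Option Lab} {P : List (Instr w Reg Lab Op)} {t : Timing}
    {e : WriteEff} {N : Set Lab} (h : SecureCode A l P t e l' N) {i j : ℕ}
    (hP : Placed Q i P) (hj : j = i + P.length) (hl : Exit Q l' j) {n : ℕ}
    (hn : A.SecureAt Q n j) (hq : t = .high → A.QuietAt Q n j) : A.SecureAt Q n i := by
  induction h generalizing i j n with
  | @straight l Bs t e hne hs _ _ =>
    obtain ⟨B, T, rfl⟩ := List.exists_cons_of_ne_nil hne
    exact secureAt_block hs (placed_relabel ⟨_, _, rfl⟩ hP).2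
      (hj.trans (by simp [relabel, block])) hn
  | @ite l _ _ _ _ _ _ _ _ _ _ _ _ _ _ _ _ _ _ hs h₁ h₂ hh hcase hbr hex hne ih₁ ih₂ =>
    have hc := SecureCode.ite (l := l) hs h₁ h₂ hh hcase hbr hex hne
    obtain ⟨n₁, n₂, -, -, -, ht, he⟩ | ⟨ht, he⟩ | ⟨hr, -, ht₁, ht₂⟩ := hcase
    · -- a branching on high data: either the branches meet again at the same time, or the
      -- program ends here
      obtain hex' | ⟨rfl, -⟩ := hl _ rfl
      · exact (hc.reachAt ht hP hj fun x hx => by cases hx; exact hex').secureAt hn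
      · exact (hc.quietAt he hP hj hl (quietAt_length n)).secureAt
    · exact (hc.quietAt he hP hj hl (hq ht)).secureAt
    · obtain ⟨i₁, i₂, i₃, i₄, hi₁, hi₂, hi₃, hi₄, rfl, pBs, pjz, p₁, pl₁, pk₁, pjmp, pbr, p₂,
        pl₂, pk₂, pnop⟩ := placed_iteCode h₂.exists_head hP hj
      have q₃ := ih₂ p₂ hi₄ pl₂.exit
        ((reachAt_nops pk₂).secureAt ((reachAt_nop pnop).secureAt hn))
        fun h => (reachAt_nops pk₂).quietAt ((reachAt_nop pnop).quietAt (hq (ht₂ h)))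
      have q₁ := ih₁ p₁ hi₂ pl₁.exit
        ((reachAt_nops pk₁).secureAt (secureAt_jmp pjmp (hl _ rfl) hn))
        fun h => (reachAt_nops pk₁).quietAt (quietAt_jmp pjmp (hl _ rfl) (hq (ht₁ h)))
      subst hi₃
      exact secureAt_block hs pBs hi₁
        ((secureAt_jz pjz (.inl pbr) hr q₃ q₁).mono (Nat.le_succ n))
  | @seq l l₁ l₂ P₁ P₂ t₁ t₂ e₁ e₂ N₁ N₂ h₁ h₂ ht _ ih₁ ih₂ =>
    obtain ⟨p₁, p₂⟩ := placed_append.1 hP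
    have hj₂ : j = i + P₁.length + P₂.length := by
      rw [hj, List.length_append, Nat.add_assoc]
    exact ih₁ p₁ rfl (h₂.resolved p₂).exit
      (ih₂ p₂ hj₂ hl hn fun h => hq (Timing.add_eq_high_iff.2 (.inr h)))
      fun h => h₂.quietAt (ht h) p₂ hj₂ hl (hq (Timing.add_eq_high_iff.2 (.inl h)))
  | @loop l l' r p lp ex P t t' e e' N hp h hh hcase hlp hex hne ih =>
    obtain ⟨-, hr, ht⟩ | ⟨ht', he'⟩ := hcase
    · obtain ⟨k, hk, rfl, p₁, pjz, plp, pP, pl', p₂, pjmp⟩ := placed_loopCode hP hj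
      have hB : ∀ B ∈ [Body.load r p, Body.store p r], A.SecureBody B := by
        simp [SecureBody, hp, hr, Level.le]
      have key : ∀ m ≤ n, A.SecureAt Q m (i + 2) := by
        intro m
        induction m with
        | zero => exact fun _ _ _ _ _ _ => trivial
        | succ m ihm =>
          intro hm
          exact secureAt_jz pjz (hl _ rfl) hr (hn.mono (by omega)) (ih pP hk pl'.exit
            (secureAt_block hB p₂ rfl ((reachAt_jmp pjmp plp).secureAt (ihm (by omega))))
            fun h => absurd h ht)
      exact secureAt_block hB p₁ rfl (key n le_rfl)
    · exact ((SecureCode.loop hp h hh (.inr ⟨ht', he'⟩) hlp hex hne).quietAt he' hP hj hl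
        (hq ht')).secureAt

/-- Secure code that makes up a whole program is secure from its first position on: the program
ends after it, and by the freshness of labels its exit label does not occur. -/
theorem SecureCode.secureAt_zero {l' : Option Lab} {t : Timing} {e : WriteEff} {N : Set Lab}
    (h : SecureCode A none Q.1 t e l' N) (n : ℕ) : A.SecureAt Q n 0 := by
  refine h.secureAt (placed_self Q) (Nat.zero_add _).symm ?_ (quietAt_length n).secureAt
    fun _ => quietAt_length n
  rintro x rfl
  refine .inr ⟨rfl, fun i hi => ?_⟩
  obtain ⟨I, hI, hx⟩ := hi
  have hmem := List.mem_of_getElem? hI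
  obtain ⟨B, T, hQ⟩ := h.exists_head
  have hlab := h.labels.1
  rw [hQ] at hmem hlab
  obtain rfl | hmem := List.mem_cons.1 hmem
  · simp at hx
  · exact (hlab I hmem x hx).2 rfl

theorem SecureCode.progPoNI {l' : Option Lab} {t : Timing} {e : WriteEff} {N : Set Lab}
    (h : SecureCode A none Q.1 t e l' N) : A.ProgPoNI Q := by
  intro S S' hS hS' hlow tr
  obtain ⟨s, rfl, hs, hpc⟩ := exists_bits_eq hS
  obtain ⟨s', rfl, hs', hpc'⟩ := exists_bits_eq hS'
  have hs : AtPos Q 0 s := ⟨hs, by simp [hpc]⟩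
  have hs' : AtPos Q 0 s' := ⟨hs', by simp [hpc']⟩
  have hd := dataEq_of_lowEq hlow
  exact ⟨(h.secureAt_zero _ s s' hs hs' hd).hasTrace,
    (h.secureAt_zero _ s' s hs' hs hd.symm).hasTrace⟩

end Security

end FTNI

theorem mainTheorem4 {w : ℕ} {Var Reg Lab Op CodeLoc : Type*} [DecidableEq Reg]
    (A : FTNI.Arch w Var Reg Lab Op CodeLoc) (C : FTNI.Cmd w Var Op)
    (P : FTNI.Code w Reg Lab Op) (t : FTNI.Timing) (e : FTNI.WriteEff) (l : Option Lab)
    (Φ : FTNI.RegRec Reg Var) (N : Set Lab)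
    (hC : FTNI.CmdTyp A ∅ none C P.1 t e l Φ N) :
    A.ProgPoNI P ∧ FTNI.Arch.ProgPNI.{v} A P := by
  have h := hC.secureCode.progPoNI
  exact ⟨h, h.pni FTNI.Arch.system_clashFree⟩
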